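/- Let $n\in\mathbb N$, $0<T<\infty$, let $\Omega\subset\mathbb R^n$ and $\Lambda\subset\mathbb R$ be open, $f:\Lambda\times\Omega\times[0,T]\to\mathbb R^n$, $g:\Omega\times[0,T]\to\mathbb R^n$, and let $h:(-\infty,T]\to\mathbb R$ be left-continuous, of bounded variation on $[0,T]$, with $h(t)=h(0)$ for $t<0$. Write $\|x\|=\sum_i|x_i|$ on $\mathbb R^n$. Assume: (i) $f(\lambda,\cdot,t)$ is continuous on $\Omega$ for all $\lambda\in\Lambda$, $t\in[0,T]$; $f(\lambda,x,\cdot)$ is Lebesgue measurable on $[0,T]$ for all $\lambda\in\Lambda$, $x\in\Omega$; and there is a Lebesgue integrable $m:[0,T]\to[0,\infty)$ with $\|f(\lambda,x,t)\|\le m(t)$ on $\Lambda\times\Omega\times[0,T]$; (ii) $g(\cdot,t)$ is continuous on $\Omega$ for all $t\in[0,T]$, and there is $\widetilde m:[0,T]\to[0,\infty)$ with $\|g(x,t)\|\le\widetilde m(t)$ on $\Omega\times[0,T]$ such that the integral $\int_0^T\widetilde m(t)\,d[\mathrm{var}_0^t h]$ exists and is finite; (iii) the integral $\int_0^T g(x,s)\,dh(s)$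 exists for every $x\in\Omega$, so that $$F(\lambda,x,t)=\int_0^t f(\lambda,x,s)\,ds+\int_0^t g(x,s)\,dh(s)$$ is defined on $\Lambda\times\Omega\times[0,T]$. All integrals with respect to $h$ and $\mathrm{var}_0^t h$ are Kurzweil--Stieltjes integrals, and $\int\cdots ds$ is the Henstock--Kurzweil integral. $\int_a^b DU(\tau,t)$ denotes the Kurzweil integral, i.e. the gauge limit of $\sum_j[U(\tau_j,t_j)-U(\tau_j,t_{j-1})]$ over $\delta$-fine tagged partitions of $[a,b]$. Test functions are the $\varphi\in C^\infty(\mathbb R;\mathbb R^n)$ all of whose derivatives (including $\varphi$ itself) vanish outside $(0,T)$. A function $u\in L^1([0,T];\mathbb R^n)$ is identified with the distribution $\langle u,\varphi\rangle=\int_0^T u\cdot\varphi\,dt$, and $\langle Du,\varphi\rangle=-\langle u,\varphi'\rangle$. If $\int_0^T\gamma\,dh$ exists, the product $\gamma\,.\,Dh$ is the distributional derivative of $t\mapsto\int_0^t\gamma\,dh$. Let $x:[0,T]\to\mathbb R^n$ be regulated (all one-sided limits exist) and $\lambda\in\Lambda$. $\bullet$ $(x,\lambda)$ is a solution of the measure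 differential equation $Dx=f(\lambda,x,t)+g(x,t)\,.\,Dh$ if $x$ has bounded variation on $[0,T]$, is left-continuous on $(0,T]$, has values in $\Omega$, the function $t\mapsto f(\lambda,x(t),t)$ is in $L^1[0,T]$, the product $g(x(t),t)\,.\,Dh$ has a sense, and the equation holds as an equality of distributions. $\bullet$ $(x,\lambda)$ is a solution of the generalized ODE $\frac{dx}{d\tau}=DF(\lambda,x,t)$ if for all $s\in[0,T]$ one has $x(s)\in\Omega$, the integral $\int_0^s DF(\lambda,x(\tau),t)$ exists, and $x(s)=x(0)+\int_0^s DF(\lambda,x(\tau),t)$. Then $(x,\lambda)$ is a solution of the generalized ODE if and only if it is a solution of the measure differential equation and the latter also holds at the initial point $t=0$ (which the test functions do not see), in the sense that $$x(0+)-x(0)=g(x(0),0)\,\bigl(h(0+)-h(0)\bigr).$$ -/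

import Mathlib

open Set Filter Topology MeasureTheory
open scoped ContDiff

namespace MDE

/-- `ℝⁿ` with the norm `‖x‖ = ∑ i, |x i|`. -/
abbrev Rn (n : ℕ) : Type := PiLp 1 (fun _ : Fin n => ℝ)

/-! ### The Kurzweil integral -/

section Kurzweil

variable {X : Type*} [NormedAddCommGroup X]

/-- Tagged partitions of `[a, b]`: division points `a = t₀ ≤ t₁ ≤ ⋯ ≤ t_ν = b` and tags
`τ_j ∈ [t_j, t_{j+1}]` for `j < ν` (the sequences are irrelevant beyond these indices). -/
structure TaggedPartition (a b : ℝ) where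
  ν : ℕ
  pt : ℕ → ℝ
  tag : ℕ → ℝ
  pt_zero : pt 0 = a
  pt_last : pt ν = b
  tag_mem : ∀ j < ν, tag j ∈ Icc (pt j) (pt (j + 1))
  mono : ∀ j < ν, pt j ≤ pt (j + 1)

/-- `P` is `δ`-fine: `[t_j, t_{j+1}] ⊆ (τ_j - δ(τ_j), τ_j + δ(τ_j))` for all `j`. -/
def TaggedPartition.IsFine {a b : ℝ} (P : TaggedPartition a b) (δ : ℝ → ℝ) : Prop :=
  ∀ j < P.ν, Icc (P.pt j) (P.pt (j + 1)) ⊆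
    Ioo (P.tag j - δ (P.tag j)) (P.tag j + δ (P.tag j))

/-- The sum `∑ j, (U(τ_j, t_{j+1}) - U(τ_j, t_j))`. -/
def TaggedPartition.kurzweilSum {a b : ℝ} (P : TaggedPartition a b) (U : ℝ → ℝ → X) : X :=
  ∑ j ∈ Finset.range P.ν, (U (P.tag j) (P.pt (j + 1)) - U (P.tag j) (P.pt j))

/-- For `a ≤ b`: the Kurzweil integral `∫_a^b DU(τ, t)` exists and equals `I`. -/
def HasKurzweilIntegral (U : ℝ → ℝ → X) (a b : ℝ) (I : X) : Prop :=
  ∀ ε > 0, ∃ δ : ℝ → ℝ, (∀ τ ∈ Icc a b, 0 < δ τ) ∧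
    ∀ P : TaggedPartition a b, P.IsFine δ → ‖P.kurzweilSum U - I‖ < ε

/-- `U` is Kurzweil integrable on `[a, b]`. -/
def KurzweilIntegrable (U : ℝ → ℝ → X) (a b : ℝ) : Prop :=
  ∃ I, HasKurzweilIntegral U a b I

open Classical in
/-- The Kurzweil integral `∫_a^b DU(τ, t)` (with the value `0` where it does not exist). -/
noncomputable def kurzweilIntegral (U : ℝ → ℝ → X) (a b : ℝ) : X :=
  if H : KurzweilIntegrable U a b then H.choose else 0

variable [NormedSpace ℝ X]

/-- The Kurzweil-Stieltjes integral `∫_a^b g dh` of a vector function `g` with respect to a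
scalar function `h` exists. -/
def KSIntegrable (g : ℝ → X) (h : ℝ → ℝ) (a b : ℝ) : Prop :=
  KurzweilIntegrable (fun τ t => h t • g τ) a b

/-- The Kurzweil-Stieltjes integral `∫_a^b g dh`. For `h = id` this is the Henstock-Kurzweil
integral `∫_a^b g(s) ds`. -/
noncomputable def ksIntegral (g : ℝ → X) (h : ℝ → ℝ) (a b : ℝ) : X :=
  kurzweilIntegral (fun τ t => h t • g τ) a b

end Kurzweil

/-- `x` is regulated on `[0, T]`: all one-sided limits inside `[0, T]` exist. -/
def RegulatedOn {X : Type*} [TopologicalSpace X] (x : ℝ → X) (T : ℝ) : Prop :=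
  (∀ t ∈ Ioc 0 T, ∃ l, Tendsto x (𝓝[<] t) (𝓝 l)) ∧
  (∀ t ∈ Ico 0 T, ∃ l, Tendsto x (𝓝[>] t) (𝓝 l))

/-! ### Distributions -/

/-- Test functions: smooth functions `φ : ℝ → ℝⁿ` all of whose derivatives (including `φ`
itself) vanish outside `(0, T)`. -/
structure TestFun (n : ℕ) (T : ℝ) where
  toFun : ℝ → Rn n
  smooth : ContDiff ℝ ∞ toFun
  vanish : ∀ (j : ℕ) (t : ℝ), t ∉ Ioo 0 T → iteratedDeriv j toFun t = 0

/-- The derivative `φ'` of a test function. -/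
noncomputable def TestFun.derivative {n : ℕ} {T : ℝ} (φ : TestFun n T) : TestFun n T where
  toFun := deriv φ.toFun
  smooth := (contDiff_infty_iff_deriv.1 φ.smooth).2
  vanish := fun j t ht => by
    rw [← iteratedDeriv_succ']
    exact φ.vanish (j + 1) t ht

/-- The functional `⟨u, φ⟩ = ∫_0^T u(t) · φ(t) dt` given by a Lebesgue integrable function
`u : [0, T] → ℝⁿ`. -/
noncomputable def ofFun {n : ℕ} (T : ℝ) (u : ℝ → Rn n) : TestFun n T → ℝ :=
  fun φ => ∫ t in (0 : ℝ)..T, ∑ i, u t i * φ.toFun t i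

/-- The distributional derivative `⟨DL, φ⟩ = -⟨L, φ'⟩`. -/
noncomputable def distDeriv {n : ℕ} {T : ℝ} (L : TestFun n T → ℝ) : TestFun n T → ℝ :=
  fun φ => -L φ.derivative

/-- The product `g . Dh`, i.e. the distributional derivative of `t ↦ ∫_0^t g dh`; it has a
sense if `KSIntegrable g h 0 T`. -/
noncomputable def mulDeriv {n : ℕ} (T : ℝ) (g : ℝ → Rn n) (h : ℝ → ℝ) : TestFun n T → ℝ :=
  distDeriv (ofFun T fun t => ksIntegral g h 0 t)

/-! ### The two equations -/

/-- `(x, lam)` is a solution on `[0, T]` of the measure differential equation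
`Dx = f(lam, x, t) + g(x, t) . Dh`. -/
structure IsMDESolution {n : ℕ} (T : ℝ) (Λ : Set ℝ) (Ω : Set (Rn n))
    (f : ℝ → Rn n → ℝ → Rn n) (g : Rn n → ℝ → Rn n) (h : ℝ → ℝ)
    (x : ℝ → Rn n) (lam : ℝ) : Prop where
  param_mem : lam ∈ Λ
  boundedVariation : BoundedVariationOn x (Icc 0 T)
  leftContinuous : ∀ t ∈ Ioc 0 T, ContinuousWithinAt x (Iic t) t
  mem : ∀ t ∈ Icc 0 T, x t ∈ Ω
  /-- `t ↦ f(lam, x(t), t)` is a distribution on `[0, T]` -/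
  integrable : IntegrableOn (fun t => f lam (x t) t) (Icc 0 T)
  /-- the product `g(x, t) . Dh` has a sense -/
  product : KSIntegrable (fun t => g (x t) t) h 0 T
  equation : ∀ φ : TestFun n T,
    distDeriv (ofFun T x) φ =
      ofFun T (fun t => f lam (x t) t) φ + mulDeriv T (fun t => g (x t) t) h φ

/-- `(x, lam)` is a solution on `[0, T]` of the generalized ODE `dx/dτ = DF(lam, x, t)`:
`x(s) = x(0) + ∫_0^s DF(lam, x(τ), t)` for all `s`, the integral being required to exist. -/
structure IsGODESolution {n : ℕ} (T : ℝ) (Λ : Set ℝ) (Ω : Set (Rn n))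
    (F : ℝ → Rn n → ℝ → Rn n) (x : ℝ → Rn n) (lam : ℝ) : Prop where
  param_mem : lam ∈ Λ
  regulated : RegulatedOn x T
  mem : ∀ s ∈ Icc 0 T, x s ∈ Ω
  equation : ∀ s ∈ Icc 0 T,
    HasKurzweilIntegral (fun τ t => F lam (x τ) t) 0 s (x s - x 0)

/-- `F(lam, x, t) = ∫_0^t f(lam, x, s) ds + ∫_0^t g(x, s) dh(s)`. -/
noncomputable def rhs {n : ℕ} (f : ℝ → Rn n → ℝ → Rn n) (g : Rn n → ℝ → Rn n) (h : ℝ → ℝ) :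
    ℝ → Rn n → ℝ → Rn n :=
  fun lam x t => ksIntegral (fun s => f lam x s) id 0 t + ksIntegral (fun s => g x s) h 0 t

/-- The equation holds at the initial point `0`, which test functions do not see: the jump
there is `x(0+) - x(0) = (h(0+) - h(0)) g(x(0), 0)`. -/
def InitialJump {n : ℕ} (g : Rn n → ℝ → Rn n) (h : ℝ → ℝ) (x : ℝ → Rn n) : Prop :=
  Tendsto (fun t => x t - x 0 - (h t - h 0) • g (x 0) 0) (𝓝[>] 0) (𝓝 0)

end MDE

namespace MDE

/-! ### Fine partitions tagged at endpoints -/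

/-! For a regulated `x` with values in Ω, the generalized equation, and the measure equation
together with its jump condition, both amount to the integral equation x(s) - x(0) = ∫_0^s f(λ,
x(t), t) dt + ∫_0^s g(x(t), t) dh(t) on [0, T].

For the generalized equation this rests on `hasGI_superposition`: if K(y, ·) is an indefinite
integral of k(y, ·) with respect to h, then ∫ DK(x(τ), t) = ∫ k(x(s), s) dh(s). It is used
componentwise, for f with the identity as integrator and for g with h. A regulated function
oscillates by more than ε near only finitely many points. On an interval with any other tag, the
summand K(x(τ), t) - K(x(τ), s) is exactly the integral of k(y(·), ·) with y = x(τ) there, and this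
y is within ε of x. Intervals tagged at the exceptional points contribute little, because the
majorant has small integral near those points once the points themselves are removed. Since k(·, s)
is only continuous for each s separately, passing from y to x requires dominated convergence along a
sequence of such y.

Dominated convergence for Kurzweil-Stieltjes integrals, `exists_hasKS_of_dominated`, is the other
main ingredient. The Saks-Henstock lemma and a gluing of countably many gauges give absolute
integrability with respect to the variation V of h. Hence maxima of dominated integrands are
integrable, then monotone convergence gives countable suprema, and the tail oscillation of a
dominated convergent sequence has V-integral tending to 0.

For the measure equation, integration by parts shows that x - ∫ f - ∫ g dh has zero distributional
derivative. By the du Bois-Reymond lemma it is constant almost everywhere, by left-continuity on all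
of (0, T]. The jump condition at 0 identifies the constant as x(0), because ∫ g dh has the matching
jump there (`tendsto_indefinite_right`). Conversely, bounded variation, left-continuity, the
distributional equation and the jump at 0 can all be read off the integral equation.

Tags are kept at endpoints of their intervals throughout. This gives the same integral
(`hasKurzweilIntegral_iff`), since an interval may be cut at its tag. -/

/-- `l` lists the triples `(left end, tag, right end)` of a `δ`-fine partition of `[a, b]` into
nondegenerate intervals tagged at one of their endpoints. -/
inductive FinePartition (δ : ℝ → ℝ) : ℝ → ℝ → List (ℝ × ℝ × ℝ) → Prop
  | nil (a : ℝ) : FinePartition δ a a []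
  | cons {a b c τ : ℝ} {l : List (ℝ × ℝ × ℝ)} : a < c → (τ = a ∨ τ = c) → c - a < δ τ →
      FinePartition δ c b l → FinePartition δ a b ((a, τ, c) :: l)

/-- The sum of an interval function `φ a τ c` over a list of tagged intervals. -/
def listSum {X : Type*} [AddCommMonoid X] (φ : ℝ → ℝ → ℝ → X) (l : List (ℝ × ℝ × ℝ)) : X :=
  (l.map fun p => φ p.1 p.2.1 p.2.2).sum

/-- The filter of increasingly fine partitions of `[a, b]`. -/
def fineFilter (a b : ℝ) : Filter (List (ℝ × ℝ × ℝ)) :=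
  ⨅ δ : ℝ → Ioi (0 : ℝ), 𝓟 {l | FinePartition (fun t => δ t) a b l}

/-- The gauge integral of the interval function `φ` over `[a, b]` is `I`. -/
def HasGI {X : Type*} [AddCommMonoid X] [TopologicalSpace X] (φ : ℝ → ℝ → ℝ → X) (a b : ℝ)
    (I : X) : Prop :=
  Tendsto (listSum φ) (fineFilter a b) (𝓝 I)

section ListSum

variable {X : Type*} [AddCommMonoid X] {φ ψ : ℝ → ℝ → ℝ → X} {a b c τ : ℝ}
  {l l' : List (ℝ × ℝ × ℝ)}

@[simp] lemma listSum_nil : listSum φ [] = 0 := rfl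

@[simp] lemma listSum_cons : listSum φ ((a, τ, c) :: l) = φ a τ c + listSum φ l := by
  simp [listSum]

@[simp] lemma listSum_append : listSum φ (l ++ l') = listSum φ l + listSum φ l' := by
  simp [listSum]

lemma listSum_add :
    listSum (fun a τ c => φ a τ c + ψ a τ c) l = listSum φ l + listSum ψ l := by
  induction l with
  | nil => simp
  | cons p l ih =>
    obtain ⟨a, τ, c⟩ := p
    simp only [listSum_cons, ih]
    exact add_add_add_comm _ _ _ _

lemma listSum_map {Y : Type*} [AddCommMonoid Y] (f : X →+ Y) :
    listSum (fun a τ c => f (φ a τ c)) l = f (listSum φ l) := by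
  induction l with
  | nil => simp
  | cons p l ih => obtain ⟨a, τ, c⟩ := p; simp [ih]

lemma listSum_finset_sum {ι : Type*} (F : Finset ι) (φ : ι → ℝ → ℝ → ℝ → X) :
    listSum (fun a τ c => ∑ i ∈ F, φ i a τ c) l = ∑ i ∈ F, listSum (φ i) l := by
  induction l with
  | nil => simp
  | cons p l ih => obtain ⟨a, τ, c⟩ := p; simp [ih, Finset.sum_add_distrib]

end ListSum

section ListSumReal

variable {φ ψ : ℝ → ℝ → ℝ → ℝ} {l l' : List (ℝ × ℝ × ℝ)}

lemma listSum_mul_left (r : ℝ) :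
    listSum (fun a τ c => r * φ a τ c) l = r * listSum φ l :=
  listSum_map (AddMonoidHom.mulLeft r)

lemma listSum_sub :
    listSum (fun a τ c => φ a τ c - ψ a τ c) l = listSum φ l - listSum ψ l := by
  have := listSum_add (φ := fun a τ c => φ a τ c - ψ a τ c) (ψ := ψ) (l := l)
  simp only [sub_add_cancel] at this
  linarith

lemma listSum_le_listSum (H : ∀ p ∈ l, φ p.1 p.2.1 p.2.2 ≤ ψ p.1 p.2.1 p.2.2) :
    listSum φ l ≤ listSum ψ l :=
  List.sum_le_sum H

lemma listSum_congr {X : Type*} [AddCommMonoid X] {φ ψ : ℝ → ℝ → ℝ → X}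
    (H : ∀ p ∈ l, φ p.1 p.2.1 p.2.2 = ψ p.1 p.2.1 p.2.2) :
    listSum φ l = listSum ψ l := by
  unfold listSum
  rw [List.map_congr_left H]

lemma listSum_nonneg (H : ∀ p ∈ l, 0 ≤ φ p.1 p.2.1 p.2.2) : 0 ≤ listSum φ l := by
  refine List.sum_nonneg fun x hx => ?_
  obtain ⟨p, hp, rfl⟩ := List.mem_map.1 hx
  exact H p hp

lemma abs_listSum_le : |listSum φ l| ≤ listSum (fun a τ c => |φ a τ c|) l := by
  induction l with
  | nil => simp
  | cons p l ih =>
    obtain ⟨a, τ, c⟩ := p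
    simp only [listSum_cons]
    exact (abs_add_le _ _).trans (by gcongr)

end ListSumReal

namespace FinePartition

variable {δ δ' : ℝ → ℝ} {a b c τ : ℝ} {l l' : List (ℝ × ℝ × ℝ)}

lemma le (H : FinePartition δ a b l) : a ≤ b := by
  induction H with
  | nil a => exact le_rfl
  | cons h1 _ _ _ ih => exact h1.le.trans ih

lemma mem (H : FinePartition δ a b l) : ∀ p ∈ l, a ≤ p.1 ∧ p.1 < p.2.2 ∧ p.2.2 ≤ b ∧
    (p.2.1 = p.1 ∨ p.2.1 = p.2.2) ∧ p.2.2 - p.1 < δ p.2.1 := by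
  induction H with
  | nil a => simp
  | cons h1 h2 h3 h4 ih =>
    intro p hp
    rcases List.mem_cons.1 hp with rfl | hp
    · exact ⟨le_rfl, h1, h4.le, h2, h3⟩
    · obtain ⟨i1, i2, i3, i4, i5⟩ := ih p hp
      exact ⟨h1.le.trans i1, i2, i3, i4, i5⟩

lemma tag_mem (H : FinePartition δ a b l) : ∀ p ∈ l, p.2.1 ∈ Icc a b := by
  intro p hp
  obtain ⟨i1, i2, i3, i4, i5⟩ := H.mem p hp
  rcases i4 with i4 | i4 <;> rw [i4] <;> constructor <;> linarith

lemma mono (H : FinePartition δ a b l) (hδ : ∀ t, δ t ≤ δ' t) : FinePartition δ' a b l := by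
  induction H with
  | nil a => exact .nil a
  | cons h1 h2 h3 _ ih => exact .cons h1 h2 (h3.trans_le (hδ _)) ih

lemma append (H : FinePartition δ a b l) (H' : FinePartition δ b c l') :
    FinePartition δ a c (l ++ l') := by
  induction H with
  | nil a => exact H'
  | cons h1 h2 h3 _ ih => exact .cons h1 h2 h3 (ih H')

/-- A gauge that separates `b` from the other tags makes `b` a division point. -/
lemma split (H : FinePartition δ a c l) (hab : a ≤ b) (hbc : b ≤ c)
    (hδ : ∀ t, t ≠ b → δ t ≤ |t - b|) :
    ∃ l₁ l₂, l = l₁ ++ l₂ ∧ FinePartition δ a b l₁ ∧ FinePartition δ b c l₂ := by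
  induction H with
  | nil a =>
    obtain rfl : a = b := le_antisymm hab hbc
    exact ⟨[], [], rfl, .nil _, .nil _⟩
  | @cons a c d τ l h1 h2 h3 h4 ih =>
    rcases hab.eq_or_lt with rfl | hab
    · exact ⟨[], _, rfl, .nil _, .cons h1 h2 h3 h4⟩
    rcases le_or_gt d b with hd | hd
    · obtain ⟨l₁, l₂, rfl, e1, e2⟩ := ih hd hbc
      exact ⟨_, l₂, rfl, .cons h1 h2 h3 e1, e2⟩
    -- An interval that contains `b` in its interior is longer than the distance from either
    -- endpoint to `b`, so neither endpoint can be its tag.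
    · exfalso
      rcases h2 with rfl | rfl
      · have := hδ τ hab.ne
        rw [abs_of_neg (by linarith)] at this
        linarith
      · have := hδ τ hd.ne'
        rw [abs_of_pos (by linarith)] at this
        linarith

end FinePartition

/-- **Cousin's lemma** as an induction principle. -/
lemma cousin_induction {P : ℝ → ℝ → Prop} {a b : ℝ} (hab : a ≤ b)
    (refl : ∀ t, P t t) (trans : ∀ r s t, a ≤ r → r ≤ s → s ≤ t → t ≤ b → P r s → P s t → P r t)
    (right : ∀ t, ∃ η > 0, ∀ s, a ≤ t → t < s → s ≤ b → s < t + η → P t s)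
    (left : ∀ t, ∃ η > 0, ∀ s, a ≤ s → s < t → t ≤ b → t - η < s → P s t) : P a b := by
  set S := {s | s ∈ Icc a b ∧ P a s} with hS
  have haS : a ∈ S := ⟨⟨le_rfl, hab⟩, refl a⟩
  have hSb : BddAbove S := ⟨b, fun s hs => hs.1.2⟩
  set z := sSup S with hz
  have haz : a ≤ z := le_csSup hSb haS
  have hzb : z ≤ b := csSup_le ⟨a, haS⟩ fun s hs => hs.1.2
  have hzS : P a z := by
    obtain ⟨η, hη, H⟩ := left z
    obtain ⟨s, hs, hsz⟩ := exists_lt_of_lt_csSup ⟨a, haS⟩ (show z - η < sSup S by linarith)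
    rcases (le_csSup hSb hs).eq_or_lt with e | e
    · rw [hz, ← e]; exact hs.2
    · exact trans a s z le_rfl hs.1.1 e.le hzb hs.2 (H s hs.1.1 e hzb hsz)
  rcases hzb.eq_or_lt with e | e
  · rwa [e] at hzS
  exfalso
  obtain ⟨η, hη, H⟩ := right z
  have h1 : z < min b (z + η / 2) := lt_min e (by linarith)
  have h2 : min b (z + η / 2) ∈ S := by
    refine ⟨⟨haz.trans h1.le, min_le_left _ _⟩, ?_⟩
    refine trans a z _ le_rfl haz h1.le (min_le_left _ _) hzS (H _ haz h1 (min_le_left _ _) ?_)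
    exact (min_le_right _ _).trans_lt (by linarith)
  exact absurd (le_csSup hSb h2) (not_le.2 h1)

lemma exists_finePartition {δ : ℝ → ℝ} (hδ : ∀ t, 0 < δ t) {a b : ℝ} (hab : a ≤ b) :
    ∃ l, FinePartition δ a b l := by
  refine cousin_induction (P := fun s t => ∃ l, FinePartition δ s t l) hab
    (fun t => ⟨[], .nil t⟩) ?_ ?_ ?_
  · rintro r s t - - - - ⟨l, hl⟩ ⟨l', hl'⟩
    exact ⟨_, hl.append hl'⟩
  · exact fun t => ⟨δ t, hδ t, fun s _ hs _ h => ⟨_, .cons hs (.inl rfl) (by linarith) (.nil s)⟩⟩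
  · exact fun t => ⟨δ t, hδ t, fun s _ hs _ h => ⟨_, .cons hs (.inr rfl) (by linarith) (.nil t)⟩⟩

lemma eventually_fineFilter {a b : ℝ} {p : List (ℝ × ℝ × ℝ) → Prop} :
    (∀ᶠ l in fineFilter a b, p l) ↔
      ∃ δ : ℝ → ℝ, (∀ t, 0 < δ t) ∧ ∀ l, FinePartition δ a b l → p l := by
  have hb : (fineFilter a b).HasBasis (fun _ => True)
      fun δ : ℝ → Ioi (0 : ℝ) => {l | FinePartition (fun t => δ t) a b l} := by
    refine hasBasis_iInf_principal fun δ₁ δ₂ => ?_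
    refine ⟨fun t => ⟨min (δ₁ t) (δ₂ t), mem_Ioi.2 (lt_min (δ₁ t).2 (δ₂ t).2)⟩, ?_, ?_⟩
    · exact fun l hl => FinePartition.mono hl fun t => min_le_left _ _
    · exact fun l hl => FinePartition.mono hl fun t => min_le_right _ _
  rw [hb.eventually_iff]
  constructor
  · rintro ⟨δ, -, H⟩
    exact ⟨fun t => δ t, fun t => (δ t).2, fun l hl => H hl⟩
  · rintro ⟨δ, h0, H⟩
    exact ⟨fun t => ⟨δ t, h0 t⟩, trivial, fun l hl => H l hl⟩

lemma fineFilter_neBot {a b : ℝ} (hab : a ≤ b) : (fineFilter a b).NeBot := by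
  refine ⟨fun h => ?_⟩
  have : ∀ᶠ l in fineFilter a b, False := by rw [h]; exact eventually_bot
  obtain ⟨δ, h0, H⟩ := eventually_fineFilter.1 this
  obtain ⟨l, hl⟩ := exists_finePartition h0 hab
  exact H l hl

lemma eventually_finePartition {δ : ℝ → ℝ} (hδ : ∀ t, 0 < δ t) (a b : ℝ) :
    ∀ᶠ l in fineFilter a b, FinePartition δ a b l :=
  eventually_fineFilter.2 ⟨δ, hδ, fun _ h => h⟩

lemma eventually_partition (a b : ℝ) :
    ∀ᶠ l in fineFilter a b, FinePartition (fun _ => 1) a b l :=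
  eventually_finePartition (fun _ => one_pos) a b

lemma fineFilter_self (a : ℝ) : fineFilter a a = pure [] := by
  refine le_antisymm ?_ ?_
  · rw [le_pure_iff]
    filter_upwards [eventually_partition a a] with l hl
    cases hl with
    | nil => rfl
    | cons h1 _ _ h4 => exact absurd h4.le (not_le.2 h1)
  · intro s hs
    obtain ⟨δ, h0, H⟩ := eventually_fineFilter.1 hs
    exact H [] (.nil a)

/-- Bounding the gauge by |t - b| away from `b` forces `b` to be a division point, so that
properties of fine partitions of the two halves can be combined. -/
lemma eventually_fineFilter_append {a b c : ℝ} (hab : a ≤ b) (hbc : b ≤ c)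
    {p q : List (ℝ × ℝ × ℝ) → Prop} (hp : ∀ᶠ l in fineFilter a b, p l)
    (hq : ∀ᶠ l in fineFilter b c, q l) :
    ∀ᶠ l in fineFilter a c, ∃ l₁ l₂, l = l₁ ++ l₂ ∧ p l₁ ∧ q l₂ := by
  obtain ⟨δ₁, h1, H1⟩ := eventually_fineFilter.1 hp
  obtain ⟨δ₂, h2, H2⟩ := eventually_fineFilter.1 hq
  refine eventually_fineFilter.2
    ⟨fun t => min (min (δ₁ t) (δ₂ t)) (if t = b then 1 else |t - b|), fun t => ?_, fun l hl => ?_⟩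
  · refine lt_min (lt_min (h1 t) (h2 t)) ?_
    split_ifs with ht
    · exact one_pos
    · exact abs_pos.2 (sub_ne_zero.2 ht)
  · obtain ⟨l₁, l₂, rfl, e1, e2⟩ := hl.split hab hbc fun t ht => by
      simp only [if_neg ht]; exact min_le_right _ _
    exact ⟨l₁, l₂, rfl,
      H1 _ (e1.mono fun t => (min_le_left _ _).trans (min_le_left _ _)),
      H2 _ (e2.mono fun t => (min_le_left _ _).trans (min_le_right _ _))⟩

/-! ### Basic properties of the gauge integral -/

namespace HasGI

section Basic

variable {X : Type*} [NormedAddCommGroup X] {φ ψ : ℝ → ℝ → ℝ → X} {a b c : ℝ} {I J : X}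

lemma unique (hab : a ≤ b) (H : HasGI φ a b I) (H' : HasGI φ a b J) : I = J :=
  have := fineFilter_neBot hab
  tendsto_nhds_unique H H'

lemma add (H : HasGI φ a b I) (H' : HasGI ψ a b J) :
    HasGI (fun a τ c => φ a τ c + ψ a τ c) a b (I + J) := by
  unfold HasGI
  exact (Tendsto.add H H').congr fun l => listSum_add.symm

lemma congr (H : HasGI φ a b I) (e : ∀ s τ t, a ≤ s → s < t → t ≤ b → (τ = s ∨ τ = t) →
    φ s τ t = ψ s τ t) : HasGI ψ a b I := by
  refine Tendsto.congr' ?_ H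
  filter_upwards [eventually_partition a b] with l hl
  refine listSum_congr fun p hp => ?_
  obtain ⟨i1, i2, i3, i4, -⟩ := hl.mem p hp
  exact e _ _ _ i1 i2 i3 i4

lemma refl (φ : ℝ → ℝ → ℝ → X) (a : ℝ) : HasGI φ a a 0 := by
  unfold HasGI
  rw [fineFilter_self]
  exact tendsto_pure_nhds _ _

lemma eq_zero_of_self (H : HasGI φ a a I) : I = 0 := H.unique le_rfl (refl φ a)

lemma trans (hab : a ≤ b) (hbc : b ≤ c) (H : HasGI φ a b I) (H' : HasGI φ b c J) :
    HasGI φ a c (I + J) := by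
  rw [HasGI, Metric.tendsto_nhds] at *
  intro ε hε
  filter_upwards [eventually_fineFilter_append hab hbc (H (ε / 2) (half_pos hε))
    (H' (ε / 2) (half_pos hε))] with l hl
  obtain ⟨l₁, l₂, rfl, h1, h2⟩ := hl
  rw [listSum_append]
  exact (dist_add_add_le _ _ _ _).trans_lt (by linarith)

lemma map {Y : Type*} [NormedAddCommGroup Y] (H : HasGI φ a b I) (f : X →+ Y)
    (hf : Continuous f) : HasGI (fun a τ c => f (φ a τ c)) a b (f I) := by
  unfold HasGI
  exact ((hf.tendsto I).comp H).congr fun l => (listSum_map f).symm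

/-- Integrability passes to subintervals. -/
lemma exists_subinterval [CompleteSpace X] (H : HasGI φ a b I) {s t : ℝ} (has : a ≤ s)
    (hst : s ≤ t) (htb : t ≤ b) : ∃ K, HasGI φ s t K := by
  have := fineFilter_neBot hst
  refine cauchy_map_iff_exists_tendsto.1 ?_
  rw [cauchy_map_iff]
  refine ⟨inferInstance, ?_⟩
  rw [Metric.uniformity_basis_dist.tendsto_right_iff]
  intro ε hε
  obtain ⟨δ, h0, Hδ⟩ := eventually_fineFilter.1 (Metric.tendsto_nhds.1 H (ε / 2) (half_pos hε))
  -- Cauchy criterion: two fine partitions of `[s, t]` are completed by the same flanking pieces,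
  -- which cancel in the difference of the sums.
  obtain ⟨l₁, e1⟩ := exists_finePartition h0 has
  obtain ⟨l₂, e2⟩ := exists_finePartition h0 htb
  have hev := eventually_finePartition h0 s t
  filter_upwards [hev.prod_mk hev] with q hq
  have A := Hδ _ ((e1.append hq.1).append e2)
  have B := Hδ _ ((e1.append hq.2).append e2)
  have := dist_triangle_right (listSum φ (l₁ ++ q.1 ++ l₂)) (listSum φ (l₁ ++ q.2 ++ l₂)) I
  simp only [listSum_append, dist_add_right, dist_add_left] at *
  show dist _ _ < ε
  linarith

/-- The indefinite integral. -/
lemma exists_indefinite [CompleteSpace X] (hab : a ≤ b) (H : HasGI φ a b I) :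
    ∃ G : ℝ → X, G a = 0 ∧ G b = I ∧
      ∀ s t, a ≤ s → s ≤ t → t ≤ b → HasGI φ s t (G t - G s) := by
  choose! G hG using fun t (ht : t ∈ Icc a b) => H.exists_subinterval le_rfl ht.1 ht.2
  refine ⟨G, (hG a ⟨le_rfl, hab⟩).eq_zero_of_self, (hG b ⟨hab, le_rfl⟩).unique hab H, ?_⟩
  intro s t has hst htb
  obtain ⟨K, hK⟩ := H.exists_subinterval has hst htb
  have h1 := (hG s ⟨has, hst.trans htb⟩).trans has hst hK
  have h2 := h1.unique (has.trans hst) (hG t ⟨has.trans hst, htb⟩)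
  rw [← h2, add_sub_cancel_left]
  exact hK

end Basic

section Real

variable {φ ψ : ℝ → ℝ → ℝ → ℝ} {a b c I J : ℝ}

lemma const_mul (r : ℝ) (H : HasGI φ a b I) : HasGI (fun a τ c => r * φ a τ c) a b (r * I) :=
  H.map (AddMonoidHom.mulLeft r) (continuous_const_mul r)

lemma sub (H : HasGI φ a b I) (H' : HasGI ψ a b J) :
    HasGI (fun a τ c => φ a τ c - ψ a τ c) a b (I - J) := by
  unfold HasGI
  exact (Tendsto.sub H H').congr fun l => listSum_sub.symm

lemma le (hab : a ≤ b) (H : HasGI φ a b I) (H' : HasGI ψ a b J)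
    (e : ∀ s τ t, a ≤ s → s < t → t ≤ b → (τ = s ∨ τ = t) → φ s τ t ≤ ψ s τ t) : I ≤ J := by
  have := fineFilter_neBot hab
  refine le_of_tendsto_of_tendsto H H' ?_
  filter_upwards [eventually_partition a b] with l hl
  refine listSum_le_listSum fun p hp => ?_
  obtain ⟨i1, i2, i3, i4, -⟩ := hl.mem p hp
  exact e _ _ _ i1 i2 i3 i4

end Real

end HasGI

lemma FinePartition.listSum_diff {δ : ℝ → ℝ} {X : Type*} [AddCommGroup X] (G : ℝ → X) {a b : ℝ}
    {l : List (ℝ × ℝ × ℝ)} (H : FinePartition δ a b l) :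
    listSum (fun s _ t => G t - G s) l = G b - G a := by
  induction H with
  | nil a => simp
  | cons _ _ _ _ ih => rw [listSum_cons, ih]; abel

lemma hasGI_diff {X : Type*} [NormedAddCommGroup X] (G : ℝ → X) (a b : ℝ) :
    HasGI (fun s _ t => G t - G s) a b (G b - G a) := by
  refine tendsto_nhds_of_eventually_eq ?_
  filter_upwards [eventually_partition a b] with l hl using hl.listSum_diff G

/-! ### Sub-partitions, the Saks-Henstock lemma, gluing of gauges -/

/-- The elements of a fine partition that are fine for another gauge extend to a partition fine
for that gauge. -/
lemma FinePartition.exists_extension {δ δ' : ℝ → ℝ} {a b : ℝ} {l : List (ℝ × ℝ × ℝ)}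
    (H : FinePartition δ a b l) (h' : ∀ t, 0 < δ' t) (p : ℝ × ℝ × ℝ → Prop) [DecidablePred p]
    (hp : ∀ q ∈ l, p q → q.2.2 - q.1 < δ' q.2.1) :
    ∃ l', FinePartition δ' a b l' ∧ (l.filter p).Sublist l' := by
  induction H with
  | nil a => exact ⟨[], .nil a, by simp⟩
  | @cons a b c τ l h1 h2 h3 h4 ih =>
    obtain ⟨l', e1, e2⟩ := ih fun q hq => hp q (List.mem_cons_of_mem _ hq)
    by_cases hpc : p (a, τ, c)
    · refine ⟨(a, τ, c) :: l', .cons h1 h2 (hp _ List.mem_cons_self hpc) e1, ?_⟩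
      rw [List.filter_cons_of_pos (by simpa using hpc)]
      exact e2.cons_cons _
    · obtain ⟨l₀, e0⟩ := exists_finePartition h' h1.le
      refine ⟨l₀ ++ l', e0.append e1, ?_⟩
      rw [List.filter_cons_of_neg (by simpa using hpc)]
      exact e2.trans (List.sublist_append_right _ _)

lemma listSum_ite_eq_filter (φ : ℝ → ℝ → ℝ → ℝ) (p : ℝ × ℝ × ℝ → Prop) [DecidablePred p]
    (l : List (ℝ × ℝ × ℝ)) :
    listSum (fun a τ c => if p (a, τ, c) then φ a τ c else 0) l = listSum φ (l.filter p) := by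
  induction l with
  | nil => simp
  | cons q l ih =>
    obtain ⟨a, τ, c⟩ := q
    by_cases h : p (a, τ, c)
    · rw [List.filter_cons_of_pos (by simpa using h), listSum_cons, listSum_cons, ih, if_pos h]
    · rw [List.filter_cons_of_neg (by simpa using h), listSum_cons, ih, if_neg h, zero_add]

/-- Completing the selected elements to a full `δ'`-fine partition only adds nonnegative terms. A
bound known for full partitions thus passes to selections of elements. -/
lemma FinePartition.listSum_ite_le {δ δ' : ℝ → ℝ} {a b r : ℝ} {l : List (ℝ × ℝ × ℝ)}
    {φ : ℝ → ℝ → ℝ → ℝ} (H : FinePartition δ a b l) (h' : ∀ t, 0 < δ' t)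
    (p : ℝ × ℝ × ℝ → Prop) [DecidablePred p] (hp : ∀ q ∈ l, p q → q.2.2 - q.1 < δ' q.2.1)
    (h0 : ∀ s τ t, s ≤ t → 0 ≤ φ s τ t) (hr : ∀ l', FinePartition δ' a b l' → listSum φ l' ≤ r) :
    listSum (fun a τ c => if p (a, τ, c) then φ a τ c else 0) l ≤ r := by
  obtain ⟨l', e1, e2⟩ := H.exists_extension h' p hp
  rw [listSum_ite_eq_filter]
  refine le_trans ?_ (hr l' e1)
  refine (e2.map _).sum_le_sum fun x hx => ?_
  obtain ⟨q, hq, rfl⟩ := List.mem_map.1 hx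
  exact h0 _ _ _ (e1.mem q hq).2.1.le

/-- Gluing countably many gauges. -/
lemma exists_gauge_listSum_le {ψ : ℕ → ℝ → ℝ → ℝ → ℝ} {a b C : ℝ} {r : ℕ → ℝ}
    (h0 : ∀ k s τ t, s ≤ t → 0 ≤ ψ k s τ t)
    (H : ∀ k, ∀ᶠ l in fineFilter a b, listSum (ψ k) l ≤ r k)
    (hC : ∀ n, ∑ k ∈ Finset.range n, r k ≤ C) (N : ℝ → ℕ) :
    ∀ᶠ l in fineFilter a b,
      listSum (fun s τ t => ∑ k ∈ Finset.range (N τ), ψ k s τ t) l ≤ C := by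
  choose δ hδ Hδ using fun k => eventually_fineFilter.1 (H k)
  -- The infimum of all the gauges could vanish, but at the tag `t` only the first `N t` of them
  -- matter. For each fixed `k`, the elements with `k < N τ` are then fine for `δ k`, and the double
  -- sum can be taken over `k` last.
  have key : ∀ n : ℕ, ∃ η : ℝ → ℝ, (∀ t, 0 < η t) ∧ ∀ k < n, ∀ t, η t ≤ δ k t := by
    intro n
    induction n with
    | zero => exact ⟨fun _ => 1, fun _ => one_pos, fun k hk => absurd hk (Nat.not_lt_zero k)⟩
    | succ n ih =>
      obtain ⟨η, e1, e2⟩ := ih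
      refine ⟨fun t => min (η t) (δ n t), fun t => lt_min (e1 t) (hδ n t), fun k hk t => ?_⟩
      rcases Nat.lt_succ_iff_lt_or_eq.1 hk with hk | rfl
      · exact (min_le_left _ _).trans (e2 k hk t)
      · exact min_le_right _ _
  choose η e1 e2 using key
  refine eventually_fineFilter.2 ⟨fun t => η (N t) t, fun t => e1 _ _, fun l hl => ?_⟩
  obtain ⟨M, hM⟩ : ∃ M, ∀ p ∈ l, N p.2.1 ≤ M :=
    ⟨(l.map fun p => N p.2.1).sum, fun p hp =>
      List.single_le_sum (by simp) _ (List.mem_map.2 ⟨p, hp, rfl⟩)⟩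
  have hs : listSum (fun s τ t => ∑ k ∈ Finset.range (N τ), ψ k s τ t) l =
      listSum (fun s τ t => ∑ k ∈ Finset.range M, if k < N τ then ψ k s τ t else 0) l := by
    refine listSum_congr fun p hp => ?_
    rw [← Finset.sum_filter]
    refine Finset.sum_congr ?_ fun _ _ => rfl
    ext k
    simp only [Finset.mem_range, Finset.mem_filter]
    exact ⟨fun h => ⟨h.trans_le (hM p hp), h⟩, fun h => h.2⟩
  rw [hs, listSum_finset_sum]
  refine (Finset.sum_le_sum fun k _ => ?_).trans (hC M)
  exact hl.listSum_ite_le (hδ k) (fun q => k < N q.2.1)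
    (fun q hq hk => (hl.mem q hq).2.2.2.2.trans_le (e2 _ k hk _)) (h0 k) (Hδ k)

/-- **Saks-Henstock lemma**. -/
lemma saks_henstock {φ : ℝ → ℝ → ℝ → ℝ} {G : ℝ → ℝ} {a b : ℝ}
    (H : ∀ s t, a ≤ s → s ≤ t → t ≤ b → HasGI φ s t (G t - G s)) (hab : a ≤ b) {ε : ℝ}
    (hε : 0 < ε) :
    ∀ᶠ l in fineFilter a b, listSum (fun s τ t => |φ s τ t - (G t - G s)|) l ≤ ε := by
  obtain ⟨δ, h0, Hδ⟩ := eventually_fineFilter.1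
    (Metric.tendsto_nhds.1 (H a b le_rfl hab le_rfl) (ε / 2) (half_pos hε))
  refine eventually_fineFilter.2 ⟨δ, h0, fun l hl => ?_⟩
  -- Every element outside the selection `p` is replaced by a partition whose sum is within `η` of
  -- its exact integral. The result is still `δ`-fine, so the error of the selection alone is almost
  -- the error of a full `δ`-fine partition.
  have key : ∀ (p : ℝ × ℝ × ℝ → Prop) [DecidablePred p] (a' : ℝ), a ≤ a' →
      ∀ l, FinePartition δ a' b l → ∀ η > 0, ∃ l', FinePartition δ a' b l' ∧
        |listSum (fun s τ t => if p (s, τ, t) then φ s τ t - (G t - G s) else 0) l -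
          (listSum φ l' - (G b - G a'))| ≤ l.length * η := by
    intro p _ a' ha' l hl η hη
    induction hl with
    | nil a => exact ⟨[], .nil a, by simp⟩
    | @cons a' b c τ l h1 h2 h3 h4 ih =>
      obtain ⟨l', e1, e2⟩ := ih H hab Hδ hl (ha'.trans h1.le)
      by_cases hp : p (a', τ, c)
      · refine ⟨_, .cons h1 h2 h3 e1, ?_⟩
        rw [listSum_cons, listSum_cons, if_pos hp]
        rw [show φ a' τ c - (G c - G a') + listSum (fun s τ t => if p (s, τ, t) then
          φ s τ t - (G t - G s) else 0) l - (φ a' τ c + listSum φ l' - (G b - G a')) =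
          listSum (fun s τ t => if p (s, τ, t) then φ s τ t - (G t - G s) else 0) l -
          (listSum φ l' - (G b - G c)) by ring]
        refine e2.trans ?_
        gcongr
        simp
      · have := fineFilter_neBot h1.le
        obtain ⟨l₀, f1, f2⟩ := ((eventually_finePartition h0 a' c).and
          (Metric.tendsto_nhds.1 (H a' c ha' h1.le h4.le) η hη)).exists
        refine ⟨_, f1.append e1, ?_⟩
        rw [listSum_cons, listSum_append, if_neg hp]
        rw [Real.dist_eq] at f2
        push_cast [List.length_cons]
        rw [abs_le] at e2 ⊢
        rw [abs_lt] at f2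
        constructor <;> linarith
  have key2 : ∀ (p : ℝ × ℝ × ℝ → Prop) [DecidablePred p],
      |listSum (fun s τ t => if p (s, τ, t) then φ s τ t - (G t - G s) else 0) l| ≤ ε / 2 := by
    intro p _
    refine le_of_forall_pos_le_add fun η hη => ?_
    obtain ⟨l', e1, e2⟩ := key p a le_rfl l hl (η / (l.length + 1)) (by positivity)
    have e3 := Hδ l' e1
    rw [Real.dist_eq] at e3
    have e4 : (l.length : ℝ) * (η / (l.length + 1)) ≤ η := by
      rw [mul_div_assoc', div_le_iff₀ (by positivity)]
      nlinarith
    rw [abs_le] at e2 ⊢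
    rw [abs_lt] at e3
    constructor <;> linarith
  classical
  -- Selecting the nonnegative and the negative errors separately turns the bound on signed sums
  -- into one on the sum of absolute values, at the cost of a factor 2.
  have A := key2 fun q => 0 ≤ φ q.1 q.2.1 q.2.2 - (G q.2.2 - G q.1)
  have B := key2 fun q => ¬ 0 ≤ φ q.1 q.2.1 q.2.2 - (G q.2.2 - G q.1)
  have e : listSum (fun s τ t => |φ s τ t - (G t - G s)|) l =
      listSum (fun s τ t => if 0 ≤ φ s τ t - (G t - G s) then φ s τ t - (G t - G s) else 0) l -
      listSum (fun s τ t => if ¬ 0 ≤ φ s τ t - (G t - G s) then φ s τ t - (G t - G s) else 0) l := by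
    rw [← listSum_sub]
    refine listSum_congr fun p _ => ?_
    by_cases hp : 0 ≤ φ p.1 p.2.1 p.2.2 - (G p.2.2 - G p.1)
    · simp only [hp, if_true, not_true, if_false, sub_zero, abs_of_nonneg]
    · simp only [hp, if_false, not_false_iff, if_true, zero_sub]
      exact abs_of_neg (not_le.1 hp)
  rw [e]
  rw [abs_le] at A B
  linarith

/-! ### Scalar Kurzweil-Stieltjes integrals and variation functions -/

/-- The Kurzweil-Stieltjes integral of the scalar function `u` with respect to `h` over `[a, b]`
is `I`. -/
def HasKS (u h : ℝ → ℝ) (a b I : ℝ) : Prop :=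
  HasGI (fun s τ t => u τ * (h t - h s)) a b I

/-- `V` is a variation function of `h`. -/
structure IsVariation (h V : ℝ → ℝ) : Prop where
  mono : Monotone V
  abs_le : ∀ s t, s ≤ t → |h t - h s| ≤ V t - V s
  approx : ∀ a b, a ≤ b → ∀ ε > 0, ∀ᶠ l in fineFilter a b,
    listSum (fun s _ t => V t - V s - |h t - h s|) l ≤ ε

namespace HasKS

variable {u v h V : ℝ → ℝ} {a b I J : ℝ}

lemma add (H : HasKS u h a b I) (H' : HasKS v h a b J) :
    HasKS (fun s => u s + v s) h a b (I + J) :=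
  (HasGI.add H H').congr fun _ _ _ _ _ _ _ => by ring

lemma sub (H : HasKS u h a b I) (H' : HasKS v h a b J) :
    HasKS (fun s => u s - v s) h a b (I - J) :=
  (HasGI.sub H H').congr fun _ _ _ _ _ _ _ => by ring

lemma const_mul (r : ℝ) (H : HasKS u h a b I) : HasKS (fun s => r * u s) h a b (r * I) :=
  (HasGI.const_mul r H).congr fun _ _ _ _ _ _ _ => by ring

lemma congr (H : HasKS u h a b I) (e : ∀ s ∈ Icc a b, u s = v s) : HasKS v h a b I := by
  refine HasGI.congr H fun s τ t h1 h2 h3 h4 => ?_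
  rw [e τ]
  rcases h4 with rfl | rfl <;> constructor <;> linarith

lemma le (hV : Monotone V) (hab : a ≤ b) (H : HasKS u V a b I) (H' : HasKS v V a b J)
    (e : ∀ s ∈ Icc a b, u s ≤ v s) : I ≤ J := by
  refine HasGI.le hab H H' fun s τ t h1 h2 h3 h4 => ?_
  refine mul_le_mul_of_nonneg_right (e τ ?_) (sub_nonneg.2 (hV h2.le))
  rcases h4 with rfl | rfl <;> constructor <;> linarith

lemma nonneg (hV : Monotone V) (hab : a ≤ b) (H : HasKS u V a b I) (e : ∀ s ∈ Icc a b, 0 ≤ u s) :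
    0 ≤ I := by
  have := const_mul 0 H
  simp only [zero_mul] at this
  exact this.le hV hab H e

lemma abs_le (hV : IsVariation h V) (hab : a ≤ b) (H : HasKS u h a b I) (H' : HasKS v V a b J)
    (e : ∀ s ∈ Icc a b, |u s| ≤ v s) : |I| ≤ J := by
  have key : ∀ s τ t, a ≤ s → s < t → t ≤ b → (τ = s ∨ τ = t) →
      |u τ * (h t - h s)| ≤ v τ * (V t - V s) := by
    intro s τ t h1 h2 h3 h4
    rw [abs_mul]
    have hτ := e τ (by rcases h4 with rfl | rfl <;> constructor <;> linarith)
    exact mul_le_mul hτ (hV.abs_le s t h2.le) (abs_nonneg _) ((abs_nonneg _).trans hτ)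
  have h1 : I ≤ J := HasGI.le hab H H' fun s τ t h1 h2 h3 h4 =>
    (le_abs_self _).trans (key s τ t h1 h2 h3 h4)
  have h2 : -1 * I ≤ J := HasGI.le hab (HasGI.const_mul (-1) H) H' fun s τ t h1 h2 h3 h4 => by
    rw [neg_one_mul]
    exact (neg_le_abs _).trans (key s τ t h1 h2 h3 h4)
  rw [abs_le']
  constructor <;> linarith

end HasKS

lemma sum_div_two_pow_le {ε : ℝ} (hε : 0 ≤ ε) (n : ℕ) :
    ∑ k ∈ Finset.range n, ε / 2 ^ (k + 1) ≤ ε := by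
  have h := sum_geometric_two_le n
  have e : ∑ k ∈ Finset.range n, ε / 2 ^ (k + 1) =
      ε / 2 * ∑ k ∈ Finset.range n, (1 / (2 : ℝ)) ^ k := by
    rw [Finset.mul_sum]
    refine Finset.sum_congr rfl fun k _ => ?_
    rw [pow_succ, one_div, inv_pow]
    field_simp
  rw [e]
  nlinarith

/-! ### Total variation as a gauge integral -/

lemma boundedVariationOn_of_dist_le {X : Type*} [PseudoMetricSpace X] {G : ℝ → X} {M : ℝ → ℝ}
    {a b : ℝ} (H : ∀ s t, a ≤ s → s ≤ t → t ≤ b → dist (G s) (G t) ≤ M t - M s) :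
    BoundedVariationOn G (Icc a b) := by
  refine ne_top_of_le_ne_top (ENNReal.ofReal_ne_top (r := M b - M a)) (iSup_le ?_)
  rintro ⟨n, u, hu, hus⟩
  have key : ∀ i ∈ Finset.range n, edist (G (u (i + 1))) (G (u i)) ≤
      ENNReal.ofReal (M (u (i + 1)) - M (u i)) := by
    intro i _
    rw [edist_dist, dist_comm]
    exact ENNReal.ofReal_le_ofReal (H _ _ (hus i).1 (hu i.le_succ) (hus (i + 1)).2)
  refine (Finset.sum_le_sum key).trans ?_
  rw [← ENNReal.ofReal_sum_of_nonneg fun i _ =>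
    dist_nonneg.trans (H _ _ (hus i).1 (hu i.le_succ) (hus (i + 1)).2),
    Finset.sum_range_sub fun i => M (u i)]
  refine ENNReal.ofReal_le_ofReal ?_
  have h1 := dist_nonneg.trans (H _ _ le_rfl (hus 0).1 (hus 0).2)
  have h2 := dist_nonneg.trans (H _ _ (hus n).1 (hus n).2 le_rfl)
  linarith

lemma FinePartition.listSum_abs_le_eVariationOn {δ G : ℝ → ℝ} {a b : ℝ}
    {l : List (ℝ × ℝ × ℝ)} (H : FinePartition δ a b l) :
    ENNReal.ofReal (listSum (fun s _ t => |G t - G s|) l) ≤ eVariationOn G (Icc a b) := by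
  induction H with
  | nil a => simp
  | @cons a b c τ l h1 h2 h3 h4 ih =>
    rw [listSum_cons, ENNReal.ofReal_add (abs_nonneg _) (listSum_nonneg fun _ _ => abs_nonneg _)]
    have := eVariationOn.Icc_add_Icc G h1.le h4.le (mem_univ c)
    simp only [univ_inter] at this
    rw [← this]
    refine add_le_add ?_ ih
    rw [← Real.dist_eq, ← edist_dist]
    exact eVariationOn.edist_le G (right_mem_Icc.2 h1.le) (left_mem_Icc.2 h1.le)

/-- A fine enough gauge makes every `u i` with `i ≤ n` a division point, and refining a chain does
not decrease its variation sum. -/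
lemma eventually_sum_le_listSum (G : ℝ → ℝ) {u : ℕ → ℝ} (hu : Monotone u) {a : ℝ}
    (ha : a ≤ u 0) (n : ℕ) :
    ∀ᶠ l in fineFilter a (u n),
      ∑ i ∈ Finset.range n, |G (u (i + 1)) - G (u i)| ≤ listSum (fun s _ t => |G t - G s|) l := by
  induction n with
  | zero =>
    refine Eventually.of_forall fun l => ?_
    simpa using listSum_nonneg fun _ _ => abs_nonneg _
  | succ n ih =>
    filter_upwards [eventually_fineFilter_append (ha.trans (hu n.zero_le)) (hu n.le_succ) ih
      (eventually_partition _ _)] with l hl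
    obtain ⟨l₁, l₂, rfl, h1, h2⟩ := hl
    rw [Finset.sum_range_succ, listSum_append]
    refine add_le_add h1 ?_
    rw [← h2.listSum_diff G]
    exact abs_listSum_le

/-- No sum exceeds the total variation, and a chain that nearly attains it is a subset of the
division points of every sufficiently fine partition. -/
lemma hasGI_abs_diff {G : ℝ → ℝ} {a b : ℝ} (H : BoundedVariationOn G (Icc a b)) :
    HasGI (fun s _ t => |G t - G s|) a b (eVariationOn G (Icc a b)).toReal := by
  refine tendsto_order.2 ⟨fun r hr => ?_, fun r hr => ?_⟩
  · rcases lt_or_ge r 0 with hr0 | hr0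
    · exact Eventually.of_forall fun l => hr0.trans_le (listSum_nonneg fun _ _ => abs_nonneg _)
    have h1 : ENNReal.ofReal r < eVariationOn G (Icc a b) :=
      (ENNReal.ofReal_lt_iff_lt_toReal hr0 H).2 hr
    obtain ⟨⟨n, u, hu, hus⟩, hn⟩ := lt_iSup_iff.1 h1
    have h2 : r < ∑ i ∈ Finset.range n, |G (u (i + 1)) - G (u i)| := by
      simp only [edist_dist, Real.dist_eq] at hn
      rw [← ENNReal.ofReal_sum_of_nonneg fun _ _ => abs_nonneg _] at hn
      exact (ENNReal.ofReal_lt_ofReal_iff_of_nonneg hr0).1 hn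
    filter_upwards [eventually_fineFilter_append (hus n).1 (hus n).2
      (eventually_sum_le_listSum G hu (hus 0).1 n) (Eventually.of_forall fun _ => trivial)] with l hl
    obtain ⟨l₁, l₂, rfl, h3, -⟩ := hl
    rw [listSum_append]
    have := listSum_nonneg (l := l₂) (φ := fun s _ t => |G t - G s|) fun _ _ => abs_nonneg _
    linarith
  · filter_upwards [eventually_partition a b] with l hl
    refine lt_of_le_of_lt ?_ hr
    rw [← ENNReal.ofReal_le_iff_le_toReal H]
    exact hl.listSum_abs_le_eVariationOn

/-- Results on a pair `(h, V)` thereby also apply with `V` itself as integrator. -/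
lemma isVariation_of_monotone {V : ℝ → ℝ} (hV : Monotone V) : IsVariation V V where
  mono := hV
  abs_le s t hst := (abs_of_nonneg (sub_nonneg.2 (hV hst))).le
  approx a b hab ε hε := by
    filter_upwards [eventually_partition a b] with l hl
    refine le_trans (le_of_eq ?_) hε.le
    rw [listSum_congr (ψ := fun s _ t => (0 : ℝ) * (V t - V s))]
    · rw [listSum_mul_left, zero_mul]
    · intro p hp
      rw [abs_of_nonneg (sub_nonneg.2 (hV (hl.mem p hp).2.1.le)), sub_self, zero_mul]

/-- The increment of this function over an interval is the variation of `h` there, so the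
approximation property is `hasGI_abs_diff` subtracted from a telescoping sum. -/
lemma isVariation_of_boundedVariationOn {h : ℝ → ℝ} (H : BoundedVariationOn h univ) :
    IsVariation h (variationOnFromTo h univ 0) := by
  have hl := H.locallyBoundedVariationOn
  have hd : ∀ s t, s ≤ t → variationOnFromTo h univ 0 t - variationOnFromTo h univ 0 s =
      (eVariationOn h (Icc s t)).toReal := by
    intro s t hst
    rw [← variationOnFromTo.add hl (mem_univ 0) (mem_univ s) (mem_univ t), add_sub_cancel_left,
      variationOnFromTo.eq_of_le h univ hst, univ_inter]
  have hb : ∀ s t, BoundedVariationOn h (Icc s t) := fun s t => H.mono (subset_univ _)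
  refine ⟨fun s t hst => ?_, fun s t hst => ?_, fun a b hab ε hε => ?_⟩
  · rw [← sub_nonneg, hd s t hst]
    exact ENNReal.toReal_nonneg
  · rw [hd s t hst]
    exact (hb s t).dist_le (right_mem_Icc.2 hst) (left_mem_Icc.2 hst)
  · have h1 := (hasGI_diff (variationOnFromTo h univ 0) a b).sub (hasGI_abs_diff (hb a b))
    rw [hd a b hab, sub_self] at h1
    exact (h1.eventually (gt_mem_nhds hε)).mono fun l hl => hl.le

/-! ### Absolute integrability, monotone and dominated convergence -/

namespace IsVariation

variable {h V : ℝ → ℝ} {a b : ℝ}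

/-- The defect of |Δh| against ΔV stays negligible even with an unbounded weight: the tags are
sorted by the size of `u`, and the layer `k`, where the weight is at most `k + 1`, gets a gauge
adapted to `ε / 2 ^ (k + 1) / (k + 1)`. -/
lemma eventually_listSum_mul_le (hV : IsVariation h V) (hab : a ≤ b) (u : ℝ → ℝ) {ε : ℝ}
    (hε : 0 < ε) :
    ∀ᶠ l in fineFilter a b,
      listSum (fun s τ t => |u τ| * (V t - V s - |h t - h s|)) l ≤ ε := by
  have h0 : ∀ s t, s ≤ t → 0 ≤ V t - V s - |h t - h s| := fun s t hst =>
    sub_nonneg.2 (hV.abs_le s t hst)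
  have := exists_gauge_listSum_le (a := a) (b := b) (C := ε) (r := fun k => ε / 2 ^ (k + 1))
    (ψ := fun k s τ t => if k = ⌈|u τ|⌉₊ then |u τ| * (V t - V s - |h t - h s|) else 0)
    (fun k s τ t hst => ?_) (fun k => ?_) (sum_div_two_pow_le hε.le) (fun τ => ⌈|u τ|⌉₊ + 1)
  · refine this.mono fun l hl => ?_
    simpa using hl
  · split_ifs
    · exact mul_nonneg (abs_nonneg _) (h0 s t hst)
    · exact le_rfl
  · have hk : 0 < ε / 2 ^ (k + 1) / (k + 1) := by positivity
    filter_upwards [hV.approx a b hab _ hk, eventually_partition a b] with l hl hp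
    have : listSum (fun s τ t =>
        if k = ⌈|u τ|⌉₊ then |u τ| * (V t - V s - |h t - h s|) else 0) l ≤
        listSum (fun s τ t => ((k : ℝ) + 1) * (V t - V s - |h t - h s|)) l := by
      refine listSum_le_listSum fun p hp' => ?_
      have h1 := h0 _ _ (hp.mem p hp').2.1.le
      split_ifs with hk
      · refine mul_le_mul_of_nonneg_right ?_ h1
        rw [hk]
        linarith [Nat.le_ceil |u p.2.1|]
      · positivity
    refine this.trans ?_
    rw [listSum_mul_left]
    rwa [le_div_iff₀' (by positivity)] at hl

/-- A dominated Kurzweil-Stieltjes integrable function is absolutely integrable with respect to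
the variation. -/
lemma exists_hasKS_abs (hV : IsVariation h V) (hab : a ≤ b) {u m : ℝ → ℝ} {I M : ℝ}
    (hu : HasKS u h a b I) (hm : HasKS m V a b M) (hum : ∀ s, |u s| ≤ m s) :
    ∃ J, HasKS (fun s => |u s|) V a b J := by
  obtain ⟨G, -, -, hG⟩ := hu.exists_indefinite hab
  obtain ⟨N, -, -, hN⟩ := hm.exists_indefinite hab
  -- The integral of `|u|` will be the total variation of `G`. The majorant is needed exactly for
  -- this variation to be finite.
  have hbv : BoundedVariationOn G (Icc a b) := by
    refine boundedVariationOn_of_dist_le (M := N) fun s t h1 h2 h3 => ?_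
    rw [dist_comm, Real.dist_eq]
    exact HasKS.abs_le hV h2 (hG s t h1 h2 h3) (hN s t h1 h2 h3) fun r _ => hum r
  refine ⟨(eVariationOn G (Icc a b)).toReal, Metric.tendsto_nhds.2 fun ε hε => ?_⟩
  filter_upwards [Metric.tendsto_nhds.1 (hasGI_abs_diff hbv) (ε / 3) (by positivity),
    saks_henstock hG hab (show 0 < ε / 3 by positivity),
    hV.eventually_listSum_mul_le hab u (show 0 < ε / 3 by positivity),
    eventually_partition a b] with l h1 h2 h3 h4
  -- Two errors separate |u|ΔV from |ΔG|: replacing ΔV by |Δh|, and replacing uΔh by ΔG, which the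
  -- Saks-Henstock lemma controls.
  have h5 : |listSum (fun s τ t => |u τ| * (V t - V s)) l - listSum (fun s τ t => |G t - G s|) l| ≤
      listSum (fun s τ t => |u τ * (h t - h s) - (G t - G s)|) l +
      listSum (fun s τ t => |u τ| * (V t - V s - |h t - h s|)) l := by
    rw [← listSum_sub, ← listSum_add]
    refine abs_listSum_le.trans (listSum_le_listSum fun p hp => ?_)
    have e : 0 ≤ V p.2.2 - V p.1 - |h p.2.2 - h p.1| :=
      sub_nonneg.2 (hV.abs_le _ _ (h4.mem p hp).2.1.le)
    have e2 := abs_abs_sub_abs_le (u p.2.1 * (h p.2.2 - h p.1)) (G p.2.2 - G p.1)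
    rw [abs_mul (u p.2.1)] at e2
    rw [show |u p.2.1| * (V p.2.2 - V p.1) - |G p.2.2 - G p.1| =
      (|u p.2.1| * |h p.2.2 - h p.1| - |G p.2.2 - G p.1|) +
      |u p.2.1| * (V p.2.2 - V p.1 - |h p.2.2 - h p.1|) by ring]
    refine (abs_add_le _ _).trans (add_le_add e2 ?_)
    rw [abs_of_nonneg (by positivity)]
  rw [Real.dist_eq] at *
  rw [abs_lt] at *
  rw [_root_.abs_le] at h5
  constructor <;> linarith

end IsVariation

variable {h V : ℝ → ℝ} {a b : ℝ}

/-- max(p, q) = (p + q + |p - q|) / 2, and |p - q| is integrable because `2m` dominates p - q. -/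
lemma exists_hasKS_max (hV : Monotone V) (hab : a ≤ b) {p q m : ℝ → ℝ} {P Q M : ℝ}
    (hp : HasKS p V a b P) (hq : HasKS q V a b Q) (hm : HasKS m V a b M)
    (hpm : ∀ s, |p s| ≤ m s) (hqm : ∀ s, |q s| ≤ m s) :
    ∃ J, HasKS (fun s => max (p s) (q s)) V a b J := by
  obtain ⟨J, hJ⟩ := (isVariation_of_monotone hV).exists_hasKS_abs hab (hp.sub hq) (hm.add hm)
    fun s => (abs_sub _ _).trans (add_le_add (hpm s) (hqm s))
  refine ⟨_, (((hp.add hq).add hJ).const_mul (1 / 2)).congr fun s _ => ?_⟩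
  rcases le_total (p s) (q s) with e | e
  · rw [max_eq_right e, abs_of_nonpos (sub_nonpos.2 e)]
    ring
  · rw [max_eq_left e, abs_of_nonneg (sub_nonneg.2 e)]
    ring

/-- **Monotone convergence** for Kurzweil-Stieltjes integrals. -/
lemma hasKS_of_monotone (hV : Monotone V) (hab : a ≤ b) {w : ℕ → ℝ → ℝ} {w' : ℝ → ℝ} {J : ℕ → ℝ}
    {L : ℝ} (hw : ∀ k, HasKS (w k) V a b (J k)) (hmono : ∀ s, Monotone fun k => w k s)
    (hlim : ∀ s, Tendsto (fun k => w k s) atTop (𝓝 (w' s))) (hJ : Tendsto J atTop (𝓝 L)) :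
    HasKS w' V a b L := by
  have hJm : Monotone J := monotone_nat_of_le_succ fun k =>
    (hw k).le hV hab (hw (k + 1)) fun s _ => hmono s k.le_succ
  have hle : ∀ k s, w k s ≤ w' s := fun k s => (hmono s).ge_of_tendsto (hlim s) k
  have hVab := sub_nonneg.2 (hV hab)
  refine tendsto_order.2 ⟨fun r hr => ?_, fun r hr => ?_⟩
  · obtain ⟨k, hk⟩ := (hJ.eventually (lt_mem_nhds hr)).exists
    filter_upwards [(hw k).eventually (lt_mem_nhds hk), eventually_partition a b] with l hl hp
    refine hl.trans_le (listSum_le_listSum fun p hp' => ?_)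
    exact mul_le_mul_of_nonneg_right (hle k _) (sub_nonneg.2 (hV (hp.mem p hp').2.1.le))
  -- The error budget is ε(V b - V a) for stopping at the index `N τ`, ε for the sum of `w 0`, and ε
  -- for the glued increments. The rest is slack.
  · obtain ⟨ε, hε, hεr⟩ : ∃ ε > 0, L + ε * (V b - V a + 3) < r := by
      refine ⟨(r - L) / (2 * (V b - V a + 3)), by
        have := sub_pos.2 hr
        positivity, ?_⟩
      have : (r - L) / (2 * (V b - V a + 3)) * (V b - V a + 3) = (r - L) / 2 := by
        field_simp
      rw [this]
      linarith
    choose N hN using fun s => ((hlim s).eventually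
      (lt_mem_nhds (show w' s - ε < w' s by linarith))).exists
    -- At each tag, w' is below ε + w 0 plus the telescoping sum of the first `N τ` increments. Each
    -- increment has its own gauge, and the increments of `J` add up to at most L - J 0.
    have glue := exists_gauge_listSum_le (a := a) (b := b) (C := L - J 0 + ε)
      (r := fun k => J (k + 1) - J k + ε / 2 ^ (k + 1))
      (ψ := fun k s τ t => (w (k + 1) τ - w k τ) * (V t - V s))
      (fun k s τ t hst => mul_nonneg (sub_nonneg.2 (hmono τ k.le_succ)) (sub_nonneg.2 (hV hst)))
      (fun k => ((((hw (k + 1)).sub (hw k)).eventually (gt_mem_nhds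
        (show J (k + 1) - J k < J (k + 1) - J k + ε / 2 ^ (k + 1) by
          linarith [show 0 < ε / 2 ^ (k + 1) by positivity]))).mono fun l hl => hl.le))
      (fun n => by
        rw [Finset.sum_add_distrib, Finset.sum_range_sub]
        have h1 := sum_div_two_pow_le hε.le n
        have h2 := hJm.ge_of_tendsto hJ n
        linarith) N
    filter_upwards [glue, eventually_partition a b, (hw 0).eventually (gt_mem_nhds
      (show J 0 < J 0 + ε by linarith))] with l h1 h2 h3
    have : listSum (fun s τ t => w' τ * (V t - V s)) l ≤
        listSum (fun s τ t => ε * (V t - V s)) l + listSum (fun s τ t => w 0 τ * (V t - V s)) l +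
        listSum (fun s τ t => ∑ k ∈ Finset.range (N τ), (w (k + 1) τ - w k τ) * (V t - V s)) l := by
      rw [← listSum_add, ← listSum_add]
      refine listSum_le_listSum fun p hp => ?_
      rw [← Finset.sum_mul, Finset.sum_range_sub fun k => w k p.2.1]
      have e := sub_nonneg.2 (hV (h2.mem p hp).2.1.le)
      have := hN p.2.1
      nlinarith
    rw [listSum_mul_left, h2.listSum_diff V] at this
    linarith

/-- The partial suprema increase, remain dominated by `m`, and have integrals at most `M`, so
monotone convergence applies. -/
lemma exists_hasKS_iSup (hV : Monotone V) (hab : a ≤ b) {e : ℕ → ℝ → ℝ} {m : ℝ → ℝ} {M : ℝ}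
    (he : ∀ i, ∃ J, HasKS (e i) V a b J) (hm : HasKS m V a b M)
    (hem : ∀ i s, |e i s| ≤ m s) : ∃ J, HasKS (fun s => ⨆ i, e i s) V a b J := by
  have hbd : ∀ s, BddAbove (range fun i => e i s) := fun s =>
    ⟨m s, by rintro _ ⟨i, rfl⟩; exact (le_abs_self _).trans (hem i s)⟩
  have key : ∀ n, (∃ J, HasKS (fun s => partialSups (fun i => e i s) n) V a b J) ∧
      ∀ s, |partialSups (fun i => e i s) n| ≤ m s := by
    intro n
    induction n with
    | zero => simpa using ⟨he 0, hem 0⟩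
    | succ n ih =>
      obtain ⟨⟨J, hJ⟩, ih⟩ := ih
      obtain ⟨K, hK⟩ := he (n + 1)
      simp only [partialSups_add_one]
      exact ⟨exists_hasKS_max hV hab hJ hK hm ih (hem (n + 1)), fun s =>
        abs_max_le_max_abs_abs.trans (max_le (ih s) (hem (n + 1) s))⟩
  choose J hJ using fun n => (key n).1
  have hJm : Monotone J := monotone_nat_of_le_succ fun k =>
    (hJ k).le hV hab (hJ (k + 1)) fun s _ => (partialSups _).monotone k.le_succ
  have hJb : BddAbove (range J) := by
    refine ⟨M, ?_⟩
    rintro _ ⟨n, rfl⟩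
    exact (hJ n).le hV hab hm fun s _ => (le_abs_self _).trans ((key n).2 s)
  refine ⟨_, hasKS_of_monotone hV hab hJ (fun s => (partialSups _).monotone) (fun s => ?_)
    (tendsto_atTop_ciSup hJm hJb)⟩
  rw [← ciSup_partialSups_eq (hbd s)]
  refine tendsto_atTop_ciSup (partialSups _).monotone ?_
  rw [bddAbove_range_partialSups]
  exact hbd s

/-- Monotone convergence for w 0 - w k, which increases to w 0, shows that the limit of the
integrals of `w k` is 0. -/
lemma tendsto_zero_of_antitone (hV : Monotone V) (hab : a ≤ b) {w : ℕ → ℝ → ℝ} {J : ℕ → ℝ}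
    (hw : ∀ k, HasKS (w k) V a b (J k)) (hanti : ∀ s, Antitone fun k => w k s)
    (hlim : ∀ s, Tendsto (fun k => w k s) atTop (𝓝 0)) : Tendsto J atTop (𝓝 0) := by
  have hw0 : ∀ k s, 0 ≤ w k s := fun k s => (hanti s).le_of_tendsto (hlim s) k
  have hJa : Antitone J := antitone_nat_of_succ_le fun k =>
    (hw (k + 1)).le hV hab (hw k) fun s _ => hanti s k.le_succ
  have hJb : BddBelow (range J) := by
    refine ⟨0, ?_⟩
    rintro _ ⟨n, rfl⟩
    exact (hw n).nonneg hV hab fun s _ => hw0 n s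
  have h1 := tendsto_atTop_ciInf hJa hJb
  have h2 := hasKS_of_monotone hV hab (w' := w 0) (fun k => (hw 0).sub (hw k))
    (fun s i j hij => sub_le_sub_left (hanti s hij) _)
    (fun s => by simpa using (hlim s).const_sub (w 0 s)) (h1.const_sub (J 0))
  have h3 := HasGI.unique hab h2 (hw 0)
  rwa [show ⨅ i, J i = 0 by linarith] at h1

/-- **Dominated convergence** for Kurzweil-Stieltjes integrals. -/
lemma exists_hasKS_of_dominated (hV : IsVariation h V) (hab : a ≤ b) {u : ℕ → ℝ → ℝ}
    {u' m : ℝ → ℝ} {I : ℕ → ℝ} {M : ℝ} (hu : ∀ k, HasKS (u k) h a b (I k))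
    (hm : HasKS m V a b M) (hum : ∀ k s, |u k s| ≤ m s)
    (hlim : ∀ s, Tendsto (fun k => u k s) atTop (𝓝 (u' s))) :
    ∃ L, HasKS u' h a b L ∧ Tendsto I atTop (𝓝 L) := by
  -- Unpairing enumerates all pairs of indices at least `n`. The supremum over `i` is therefore the
  -- oscillation of the tail of the sequence, which decreases to 0 pointwise and is integrable as a
  -- countable supremum.
  set e : ℕ → ℕ → ℝ → ℝ := fun n i s => |u (n + i.unpair.1) s - u (n + i.unpair.2) s| with he
  have hd : ∀ k l s, |u k s - u l s| ≤ m s + m s := fun k l s =>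
    (abs_sub _ _).trans (add_le_add (hum k s) (hum l s))
  have hem : ∀ n i s, |e n i s| ≤ m s + m s := fun n i s => by
    rw [he, abs_abs]; exact hd _ _ _
  choose J hJ using fun n => exists_hasKS_iSup hV.mono hab (e := e n) (fun i =>
    hV.exists_hasKS_abs hab ((hu _).sub (hu _)) (hm.add hm) (hd _ _)) (hm.add hm) (hem n)
  have hbd : ∀ n s, BddAbove (range fun i => e n i s) := fun n s =>
    ⟨m s + m s, by rintro _ ⟨i, rfl⟩; exact (le_abs_self _).trans (hem n i s)⟩
  have hle : ∀ n k l s, n ≤ k → n ≤ l → |u k s - u l s| ≤ ⨆ i, e n i s := by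
    intro n k l s hk hl
    refine le_trans (le_of_eq ?_) (le_ciSup (hbd n s) (Nat.pair (k - n) (l - n)))
    simp only [he, Nat.unpair_pair]
    rw [Nat.add_sub_cancel' hk, Nat.add_sub_cancel' hl]
  have hsup : ∀ n s r, (∀ k l, n ≤ k → n ≤ l → |u k s - u l s| ≤ r) → ⨆ i, e n i s ≤ r :=
    fun n s r H => ciSup_le fun i => H _ _ (Nat.le_add_right _ _) (Nat.le_add_right _ _)
  have hJ0 : Tendsto J atTop (𝓝 0) := by
    refine tendsto_zero_of_antitone hV.mono hab hJ (fun s n n' hn => ?_) fun s => ?_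
    · exact hsup n' s _ fun k l hk hl => hle n k l s (hn.trans hk) (hn.trans hl)
    · refine Metric.tendsto_atTop.2 fun ε hε => ?_
      obtain ⟨N, hN⟩ := Metric.cauchySeq_iff.1 (hlim s).cauchySeq (ε / 2) (half_pos hε)
      refine ⟨N, fun n hn => ?_⟩
      have h1 : ⨆ i, e n i s ≤ ε / 2 := hsup n s _ fun k l hk hl =>
        (hN k (hn.trans hk) l (hn.trans hl)).le
      have h2 : 0 ≤ ⨆ i, e n i s := (abs_nonneg _).trans (hle n n n s le_rfl le_rfl)
      rw [Real.dist_eq, sub_zero, abs_of_nonneg h2]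
      linarith
  have hIJ : ∀ n k, n ≤ k → |I k - I n| ≤ J n := fun n k hk =>
    HasKS.abs_le hV hab ((hu k).sub (hu n)) (hJ n) fun s _ => hle n k n s hk le_rfl
  have hcau : CauchySeq I := by
    refine Metric.cauchySeq_iff'.2 fun ε hε => ?_
    obtain ⟨N, hN⟩ := (hJ0.eventually (gt_mem_nhds hε)).exists
    exact ⟨N, fun n hn => (hIJ N n hn).trans_lt hN⟩
  obtain ⟨L, hL⟩ := cauchySeq_tendsto_of_complete hcau
  refine ⟨L, Metric.tendsto_nhds.2 fun ε hε => ?_, hL⟩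
  obtain ⟨n, h1, h2⟩ := ((hJ0.eventually (gt_mem_nhds (show 0 < ε / 4 by positivity))).and
    (Metric.tendsto_nhds.1 hL (ε / 4) (by positivity))).exists
  have hlim' : ∀ s, |u' s - u n s| ≤ ⨆ i, e n i s := fun s =>
    le_of_tendsto ((hlim s).sub_const (u n s)).abs
      (eventually_atTop.2 ⟨n, fun k hk => hle n k n s hk le_rfl⟩)
  filter_upwards [Metric.tendsto_nhds.1 (hu n) (ε / 4) (by positivity),
    (hJ n).eventually (gt_mem_nhds (show J n < J n + ε / 4 by linarith)),
    eventually_partition a b] with l h3 h4 h5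
  have h6 : |listSum (fun s τ t => u' τ * (h t - h s)) l -
      listSum (fun s τ t => u n τ * (h t - h s)) l| ≤
      listSum (fun s τ t => (⨆ i, e n i τ) * (V t - V s)) l := by
    rw [← listSum_sub]
    refine abs_listSum_le.trans (listSum_le_listSum fun p hp => ?_)
    rw [← sub_mul, abs_mul]
    exact mul_le_mul (hlim' _) (hV.abs_le _ _ (h5.mem p hp).2.1.le) (abs_nonneg _)
      ((abs_nonneg _).trans (hlim' _))
  rw [Real.dist_eq] at *
  rw [abs_lt] at *
  rw [abs_le] at h6
  constructor <;> linarith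

/-! ### Changing the integrand at endpoints -/

section Endpoints

variable {u v h V : ℝ → ℝ} {a b c I J L : ℝ}

lemma HasKS.zero (h : ℝ → ℝ) (a b : ℝ) : HasKS (fun _ => 0) h a b 0 := by
  have := HasGI.const_mul 0 (hasGI_diff h a b)
  rwa [zero_mul] at this

/-- A gauge bounded by |t - b| off `b` forces the last interval [s, b] to be tagged at `b`. All
other terms vanish, and `s` is as close to `b` as the gauge at `b` prescribes. -/
lemma hasKS_right_endpoint (hab : a < b) (hu : ∀ s ∈ Ico a b, u s = 0)
    (hL : Tendsto h (𝓝[<] b) (𝓝 L)) : HasKS u h a b (u b * (h b - L)) := by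
  have key : ∀ (δ : ℝ → ℝ), (∀ t, t ≠ b → δ t ≤ |t - b|) → ∀ a' l, FinePartition δ a' b l →
      a ≤ a' → a' < b → ∃ s ∈ Ico a b, b - s < δ b ∧
        listSum (fun s τ t => u τ * (h t - h s)) l = u b * (h b - h s) := by
    intro δ hδ a' l hl
    induction hl with
    | nil a => exact fun _ h => absurd h (lt_irrefl _)
    | @cons a' b c τ l h1 h2 h3 h4 ih =>
      intro haa hab'
      rcases h4.le.eq_or_lt with rfl | hcb
      · cases h4 with
        | cons h5 _ _ h6 => exact absurd h6.le (not_le.2 h5)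
        | nil =>
          have : τ = c := by
            rcases h2 with rfl | rfl
            · have := hδ τ h1.ne
              rw [abs_of_neg (by linarith)] at this
              linarith
            · rfl
          subst this
          exact ⟨a', ⟨haa, h1⟩, h3, by simp⟩
      · obtain ⟨s, hs, e1, e2⟩ := ih hab hu hL hδ (haa.trans h1.le) hcb
        refine ⟨s, hs, e1, ?_⟩
        rw [listSum_cons, e2, hu τ (by rcases h2 with rfl | rfl <;> constructor <;> linarith),
          zero_mul, zero_add]
  have hlim : Tendsto (fun s => u b * (h b - h s)) (𝓝[<] b) (𝓝 (u b * (h b - L))) :=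
    (hL.const_sub _).const_mul _
  refine Metric.tendsto_nhds.2 fun ε hε => ?_
  obtain ⟨η, hη, H⟩ := mem_nhdsLT_iff_exists_Ioo_subset.1 (Metric.tendsto_nhds.1 hlim ε hε)
  refine eventually_fineFilter.2 ⟨fun t => if t = b then b - η else |t - b|, fun t => ?_,
    fun l hl => ?_⟩
  · beta_reduce
    split_ifs with ht
    · exact sub_pos.2 hη
    · exact abs_pos.2 (sub_ne_zero.2 ht)
  · obtain ⟨s, hs, e1, e2⟩ := key _ (fun t ht => by simp [if_neg ht]) a l hl le_rfl hab
    rw [e2]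
    simp only [if_true] at e1
    exact H ⟨by linarith, hs.2⟩

lemma hasKS_left_endpoint (hab : a < b) (hu : ∀ s ∈ Ioc a b, u s = 0)
    (hL : Tendsto h (𝓝[>] a) (𝓝 L)) : HasKS u h a b (u a * (L - h a)) := by
  have hlim : Tendsto (fun s => u a * (h s - h a)) (𝓝[>] a) (𝓝 (u a * (L - h a))) :=
    (hL.sub_const _).const_mul _
  refine Metric.tendsto_nhds.2 fun ε hε => ?_
  obtain ⟨η, hη, H⟩ := mem_nhdsGT_iff_exists_Ioo_subset.1 (Metric.tendsto_nhds.1 hlim ε hε)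
  refine eventually_fineFilter.2 ⟨fun t => if t = a then η - a else |t - a|, fun t => ?_,
    fun l hl => ?_⟩
  · beta_reduce
    split_ifs with ht
    · exact sub_pos.2 hη
    · exact abs_pos.2 (sub_ne_zero.2 ht)
  · cases hl with
    | nil => exact absurd hab (lt_irrefl _)
    | @cons _ _ c τ l h1 h2 h3 h4 =>
      have : τ = a := by
        rcases h2 with rfl | rfl
        · rfl
        · rw [if_neg h1.ne', abs_of_pos (by linarith)] at h3
          linarith
      subst this
      rw [listSum_cons, listSum_congr (l := l) (ψ := fun s τ t => (0 : ℝ) * (h t - h s)),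
        listSum_mul_left, zero_mul, add_zero]
      · rw [if_pos rfl] at h3
        exact H ⟨h1, by linarith⟩
      · intro p hp
        have := h4.tag_mem p hp
        rw [hu _ ⟨h1.trans_le this.1, this.2⟩]

/-- The value at the right endpoint is irrelevant for a left-continuous integrator. -/
lemma HasKS.congr_Ico (H : HasKS u h a b I) (hab : a ≤ b) (e : ∀ s ∈ Ico a b, u s = v s)
    (hb : ContinuousWithinAt h (Iic b) b) : HasKS v h a b I := by
  rcases hab.eq_or_lt with rfl | hab
  · rw [HasGI.eq_zero_of_self H]
    exact HasGI.refl _ _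
  have h1 := hasKS_right_endpoint (u := fun s => v s - u s) hab
    (fun s hs => by rw [e s hs, sub_self]) (hb.mono_left (nhdsWithin_mono _ Iio_subset_Iic_self))
  have h2 := (h1.add H).congr (v := v) fun s _ => sub_add_cancel _ _
  rwa [sub_self, mul_zero, zero_add] at h2

/-- Jordan decomposition: `h` is the difference of the monotone functions V and V - h. -/
lemma IsVariation.exists_tendsto_left (hV : IsVariation h V) (t : ℝ) :
    ∃ L, Tendsto h (𝓝[<] t) (𝓝 L) := by
  have hm : Monotone fun t => V t - h t := fun s t hst => by
    have := (le_abs_self _).trans (hV.abs_le s t hst)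
    dsimp only
    linarith
  exact ⟨_, ((hV.mono.tendsto_nhdsLT t).sub (hm.tendsto_nhdsLT t)).congr fun s => by ring⟩

lemma IsVariation.exists_tendsto_right (hV : IsVariation h V) (t : ℝ) :
    ∃ L, Tendsto h (𝓝[>] t) (𝓝 L) := by
  have hm : Monotone fun t => V t - h t := fun s t hst => by
    have := (le_abs_self _).trans (hV.abs_le s t hst)
    dsimp only
    linarith
  exact ⟨_, ((hV.mono.tendsto_nhdsGT t).sub (hm.tendsto_nhdsGT t)).congr fun s => by ring⟩

/-- Changing an endpoint value changes the integral by a multiple of a one-sided jump of `h`, and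
existence survives because `h` has one-sided limits. -/
lemma HasKS.exists_congr_Ioo (hV : IsVariation h V) (H : HasKS u h a b I) (hab : a ≤ b)
    (e : ∀ s ∈ Ioo a b, u s = v s) : ∃ J, HasKS v h a b J := by
  rcases hab.eq_or_lt with rfl | hab
  · exact ⟨0, HasGI.refl _ _⟩
  obtain ⟨L, hL⟩ := hV.exists_tendsto_left b
  obtain ⟨R, hR⟩ := hV.exists_tendsto_right a
  have h1 := hasKS_right_endpoint (u := fun s => if s = b then v s - u s else 0) hab
    (fun s hs => if_neg hs.2.ne) hL
  have h2 := hasKS_left_endpoint (u := fun s => if s = a then v s - u s else 0) hab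
    (fun s hs => if_neg hs.1.ne') hR
  refine ⟨_, ((h1.add h2).add H).congr fun s hs => ?_⟩
  rcases hs.1.eq_or_lt with rfl | h3
  · simp [hab.ne]
  rcases hs.2.eq_or_lt with rfl | h4
  · simp [hab.ne']
  · simp [h3.ne', h4.ne, e s ⟨h3, h4⟩]

lemma exists_hasKS_glue (hV : IsVariation h V) (hab : a ≤ b) (hbc : b ≤ c) (H : HasKS u h a b I)
    (H' : HasKS v h b c J) : ∃ K, HasKS (fun s => if s < b then u s else v s) h a c K := by
  obtain ⟨K, hK⟩ := H.exists_congr_Ioo (v := fun s => if s < b then u s else v s) hV hab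
    fun s hs => (if_pos hs.2).symm
  exact ⟨_, hK.trans hab hbc (H'.congr fun s hs => (if_neg (not_lt.2 hs.1)).symm)⟩

lemma exists_hasKS_indicator_Ioo (hV : IsVariation h V) (hab : a ≤ b) (H : HasKS u h a b I)
    (c d : ℝ) : ∃ J, HasKS ((Ioo c d).indicator u) h a b J := by
  rcases le_or_gt d c with hdc | hcd
  · rw [Ioo_eq_empty (not_lt.2 hdc), indicator_empty]
    exact ⟨0, HasKS.zero _ _ _⟩
  -- Projecting `c` and `d` onto [a, b] treats uniformly the cases where (c, d) lies inside, sticks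
  -- out of, or misses [a, b].
  set c' := max a (min c b) with hc'
  set d' := max a (min d b) with hd'
  have h1 : a ≤ c' := le_max_left _ _
  have h2 : c' ≤ d' := max_le_max le_rfl (min_le_min hcd.le le_rfl)
  have h3 : d' ≤ b := max_le hab (min_le_right _ _)
  obtain ⟨K, hK⟩ := HasGI.exists_subinterval H h1 h2 h3
  obtain ⟨J₁, hJ₁⟩ := (HasKS.zero h a c').exists_congr_Ioo (v := (Ioo c d).indicator u) hV h1
    fun s hs => by
      have : s < c := by
        rcases lt_max_iff.1 hs.2 with h | h
        · exact absurd hs.1 (not_lt.2 h.le)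
        · exact h.trans_le (min_le_left _ _)
      rw [indicator_of_notMem fun h => absurd h.1 (not_lt.2 this.le)]
  obtain ⟨J₂, hJ₂⟩ := HasKS.exists_congr_Ioo (v := (Ioo c d).indicator u) hV hK h2
    fun s hs => by
      have e1 : c < s := by
        have h4 := (max_lt_iff.1 hs.1).2
        rcases min_lt_iff.1 h4 with h | h
        · exact h
        · exact absurd (hs.2.trans_le h3) (not_lt.2 h.le)
      have e2 : s < d := by
        rcases lt_max_iff.1 hs.2 with h | h
        · exact absurd (h1.trans_lt hs.1) (not_lt.2 h.le)
        · exact h.trans_le (min_le_left _ _)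
      exact (indicator_of_mem (show s ∈ Ioo c d from ⟨e1, e2⟩) u).symm
  obtain ⟨J₃, hJ₃⟩ := (HasKS.zero h d' b).exists_congr_Ioo (v := (Ioo c d).indicator u) hV h3
    fun s hs => by
      have : d < s := by
        have h4 := (max_lt_iff.1 hs.1).2
        rcases min_lt_iff.1 h4 with h | h
        · exact h
        · exact absurd hs.2 (not_lt.2 h.le)
      rw [indicator_of_notMem fun h => absurd h.2 (not_lt.2 this.le)]
  exact ⟨_, (hJ₁.trans h1 h2 hJ₂).trans (h1.trans h2) h3 hJ₃⟩

end Endpoints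

/-! ### Regulated functions -/

section Regulated

variable {E : Type*} [PseudoMetricSpace E] {x : ℝ → E}

/-- A regulated function is uniformly close to step functions with values in its range, hence
to functions in any class that contains the step functions. -/
lemma exists_step_approx (hl : ∀ t, ∃ l, Tendsto x (𝓝[<] t) (𝓝 l))
    (hr : ∀ t, ∃ l, Tendsto x (𝓝[>] t) (𝓝 l)) {ε : ℝ} (hε : 0 < ε) {a b : ℝ} (hab : a ≤ b)
    (R : (ℝ → E) → ℝ → ℝ → Prop) (hself : ∀ t, R x t t)
    (hconst : ∀ s t c y, a ≤ s → s < t → t ≤ b → (∀ q ∈ Ioo s t, y q = x c) → R y s t)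
    (hglue : ∀ y₁ y₂ r s t, a ≤ r → r ≤ s → s ≤ t → t ≤ b → R y₁ r s → R y₂ s t →
      R (fun q => if q < s then y₁ q else y₂ q) r t) :
    ∃ y, R y a b ∧ ∀ q, dist (y q) (x q) ≤ ε ∧ y q ∈ range x := by
  have key : ∀ (s t : ℝ) (l : E), a ≤ s → s < t → t ≤ b →
      (∀ q ∈ Ioo s t, dist (x q) l < ε / 2) →
      ∃ y, R y s t ∧ ∀ q, dist (y q) (x q) ≤ ε ∧ y q ∈ range x := by
    intro s t l h1 h2 h3 H
    classical
    -- The constant is a value of `x` rather than the limit `l`, which need not belong to the range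
    -- of `x`.
    refine ⟨fun q => if q ∈ Ioo s t then x ((s + t) / 2) else x q,
      hconst s t ((s + t) / 2) _ h1 h2 h3 fun q hq => if_pos hq, fun q => ?_⟩
    beta_reduce
    by_cases hq : q ∈ Ioo s t
    · rw [if_pos hq]
      refine ⟨?_, mem_range_self _⟩
      have := dist_triangle_right (x ((s + t) / 2)) (x q) l
      have e1 := H q hq
      have e2 := H ((s + t) / 2) ⟨by linarith, by linarith⟩
      linarith
    · rw [if_neg hq, dist_self]
      exact ⟨hε.le, mem_range_self _⟩
  refine cousin_induction (P := fun s t => ∃ y, R y s t ∧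
    ∀ q, dist (y q) (x q) ≤ ε ∧ y q ∈ range x) hab ?_ ?_ ?_ ?_
  · exact fun t => ⟨x, hself t, fun q => ⟨by rw [dist_self]; exact hε.le, mem_range_self _⟩⟩
  · rintro r s t h1 h2 h3 h4 ⟨y₁, e1, f1⟩ ⟨y₂, e2, f2⟩
    refine ⟨_, hglue y₁ y₂ r s t h1 h2 h3 h4 e1 e2, fun q => ?_⟩
    split_ifs
    exacts [f1 q, f2 q]
  · intro t
    obtain ⟨l, hl⟩ := hr t
    obtain ⟨η, hη, H⟩ := mem_nhdsGT_iff_exists_Ioo_subset.1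
      (Metric.tendsto_nhds.1 hl (ε / 2) (half_pos hε))
    exact ⟨η - t, sub_pos.2 hη, fun s h1 h2 h3 h4 => key t s l h1 h2 h3 fun q hq =>
      H ⟨hq.1, hq.2.trans (by linarith)⟩⟩
  · intro t
    obtain ⟨l, hl⟩ := hl t
    obtain ⟨η, hη, H⟩ := mem_nhdsLT_iff_exists_Ioo_subset.1
      (Metric.tendsto_nhds.1 hl (ε / 2) (half_pos hε))
    exact ⟨t - η, sub_pos.2 hη, fun s h1 h2 h3 h4 => key s t l h1 h2 h3 fun q hq =>
      H ⟨lt_trans (by linarith) hq.1, hq.2⟩⟩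

/-- A regulated function oscillates little near all but finitely many points. -/
lemma exists_finite_oscillation (hl : ∀ t, ∃ l, Tendsto x (𝓝[<] t) (𝓝 l))
    (hr : ∀ t, ∃ l, Tendsto x (𝓝[>] t) (𝓝 l)) {ε : ℝ} (hε : 0 < ε) {a b : ℝ} (hab : a ≤ b) :
    ∃ Q : Set ℝ, Q.Finite ∧
      ∀ τ ∈ Icc a b, τ ∉ Q → ∀ᶠ q in 𝓝 τ, dist (x τ) (x q) ≤ ε := by
  have key : ∀ (s t : ℝ) (l : E), (∀ q ∈ Ioo s t, dist (x q) l < ε / 2) →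
      ∃ Q : Set ℝ, Q.Finite ∧ ∀ τ ∈ Ioo s t, τ ∉ Q → ∀ᶠ q in 𝓝 τ, dist (x τ) (x q) ≤ ε := by
    intro s t l H
    refine ⟨∅, finite_empty, fun τ hτ _ => ?_⟩
    filter_upwards [Ioo_mem_nhds hτ.1 hτ.2] with q hq
    have := dist_triangle_right (x τ) (x q) l
    have e1 := H q hq
    have e2 := H τ hτ
    linarith
  have main : ∃ Q : Set ℝ, Q.Finite ∧
      ∀ τ ∈ Ioo a b, τ ∉ Q → ∀ᶠ q in 𝓝 τ, dist (x τ) (x q) ≤ ε := by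
    refine cousin_induction (P := fun s t => ∃ Q : Set ℝ, Q.Finite ∧
      ∀ τ ∈ Ioo s t, τ ∉ Q → ∀ᶠ q in 𝓝 τ, dist (x τ) (x q) ≤ ε) hab ?_ ?_ ?_ ?_
    · exact fun t => ⟨∅, finite_empty, fun τ hτ => absurd (hτ.1.trans hτ.2) (lt_irrefl _)⟩
    · rintro r s t - - - - ⟨Q₁, f1, H1⟩ ⟨Q₂, f2, H2⟩
      refine ⟨insert s (Q₁ ∪ Q₂), (f1.union f2).insert s, fun τ hτ hQ => ?_⟩
      simp only [mem_insert_iff, mem_union, not_or] at hQ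
      rcases lt_or_gt_of_ne hQ.1 with h | h
      · exact H1 τ ⟨hτ.1, h⟩ hQ.2.1
      · exact H2 τ ⟨h, hτ.2⟩ hQ.2.2
    · intro t
      obtain ⟨l, hl⟩ := hr t
      obtain ⟨η, hη, H⟩ := mem_nhdsGT_iff_exists_Ioo_subset.1
        (Metric.tendsto_nhds.1 hl (ε / 2) (half_pos hε))
      exact ⟨η - t, sub_pos.2 hη, fun s h1 h2 h3 h4 => key t s l fun q hq =>
        H ⟨hq.1, hq.2.trans (by linarith)⟩⟩
    · intro t
      obtain ⟨l, hl⟩ := hl t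
      obtain ⟨η, hη, H⟩ := mem_nhdsLT_iff_exists_Ioo_subset.1
        (Metric.tendsto_nhds.1 hl (ε / 2) (half_pos hε))
      exact ⟨t - η, sub_pos.2 hη, fun s h1 h2 h3 h4 => key s t l fun q hq =>
        H ⟨lt_trans (by linarith) hq.1, hq.2⟩⟩
  obtain ⟨Q, f, H⟩ := main
  -- The endpoints count as exceptional because nothing is controlled on their outer sides.
  refine ⟨insert a (insert b Q), (f.insert b).insert a, fun τ hτ hQ => ?_⟩
  simp only [mem_insert_iff, not_or] at hQ
  exact H τ ⟨lt_of_le_of_ne hτ.1 (Ne.symm hQ.1), lt_of_le_of_ne hτ.2 hQ.2.1⟩ hQ.2.2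

end Regulated

/-- An integrable majorant near finitely many points, up to those points, of small integral. -/
lemma exists_small_majorant {V m : ℝ → ℝ} {a b M : ℝ} (hV : Monotone V) (hab : a ≤ b)
    (hm : HasKS m V a b M) (hm0 : ∀ s, 0 ≤ m s) {Q : Set ℝ} (hQ : Q.Finite) :
    ∀ ε > 0, ∃ κ : ℝ → ℝ, (∀ s, 0 ≤ κ s) ∧ (∃ K ≤ ε, HasKS κ V a b K) ∧
      ∃ η > 0, ∀ q ∈ Q, ∀ s, s ≠ q → |s - q| < η → m s ≤ κ s := by
  induction Q, hQ using Set.Finite.induction_on with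
  | empty =>
    exact fun ε hε => ⟨fun _ => 0, fun _ => le_rfl, ⟨0, hε.le, HasKS.zero _ _ _⟩, 1, one_pos, by simp⟩
  | @insert q Q _ _ ih =>
    intro ε hε
    obtain ⟨κ, h0, ⟨K, hK, hκ⟩, η, hη, H⟩ := ih (ε / 2) (half_pos hε)
    have hV' := isVariation_of_monotone hV
    have hi := fun c d s => indicator_nonneg (s := Ioo c d) (fun s _ => hm0 s) s
    have hi' := fun c d s => indicator_le_self' (s := Ioo c d) (f := m) (fun s _ => hm0 s) s
    -- The indicators live on one-sided neighbourhoods that omit `q`, so they tend to 0 everywhere.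
    -- With `q` included the limit could retain `m q` times the jump of `V`.
    choose I₁ hI₁ using fun j : ℕ =>
      exists_hasKS_indicator_Ioo hV' hab hm (q - 1 / ((j : ℝ) + 1)) q
    choose I₂ hI₂ using fun j : ℕ =>
      exists_hasKS_indicator_Ioo hV' hab hm q (q + 1 / ((j : ℝ) + 1))
    obtain ⟨L, hL, hlim⟩ := exists_hasKS_of_dominated hV' hab (fun j => (hI₁ j).add (hI₂ j))
      (u' := fun _ => 0) (hm.add hm) (fun j s => by
        rw [abs_of_nonneg (add_nonneg (hi _ _ s) (hi _ _ s))]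
        exact add_le_add (hi' _ _ s) (hi' _ _ s)) (fun s => by
        rw [← add_zero (0 : ℝ)]
        refine Tendsto.add ?_ ?_
        · refine tendsto_nhds_of_eventually_eq ?_
          rcases lt_or_ge s q with hs | hs
          · filter_upwards [tendsto_one_div_add_atTop_nhds_zero_nat.eventually
              (gt_mem_nhds (sub_pos.2 hs))] with j hj
            exact indicator_of_notMem (fun h => by linarith [h.1]) _
          · exact Eventually.of_forall fun j =>
              indicator_of_notMem (fun h => by linarith [h.2]) _
        · refine tendsto_nhds_of_eventually_eq ?_
          rcases lt_or_ge q s with hs | hs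
          · filter_upwards [tendsto_one_div_add_atTop_nhds_zero_nat.eventually
              (gt_mem_nhds (sub_pos.2 hs))] with j hj
            exact indicator_of_notMem (fun h => by linarith [h.2]) _
          · exact Eventually.of_forall fun j =>
              indicator_of_notMem (fun h => by linarith [h.1]) _)
    rw [HasGI.unique hab hL (HasKS.zero V a b)] at hlim
    obtain ⟨j, hj⟩ := (hlim.eventually (gt_mem_nhds (half_pos hε))).exists
    refine ⟨_, fun s => add_nonneg (h0 s) (add_nonneg (hi (q - 1 / ((j : ℝ) + 1)) q s)
      (hi q (q + 1 / ((j : ℝ) + 1)) s)), ⟨_, ?_, hκ.add ((hI₁ j).add (hI₂ j))⟩,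
      min η (1 / ((j : ℝ) + 1)), lt_min hη (by positivity), ?_⟩
    · linarith
    · intro q' hq' s hs hs'
      have e1 := hi (q - 1 / ((j : ℝ) + 1)) q s
      have e2 := hi q (q + 1 / ((j : ℝ) + 1)) s
      rcases hq' with rfl | hq'
      · have h3 := abs_lt.1 (hs'.trans_le (min_le_right _ _))
        have h4 := h0 s
        rcases lt_or_gt_of_ne hs with h | h
        · rw [indicator_of_mem (show s ∈ Ioo (q' - 1 / ((j : ℝ) + 1)) q' from
            ⟨by linarith, h⟩)] at e1 ⊢
          linarith
        · rw [indicator_of_mem (show s ∈ Ioo q' (q' + 1 / ((j : ℝ) + 1)) from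
            ⟨h, by linarith⟩)] at e2 ⊢
          linarith
      · have := H q' hq' s hs (hs'.trans_le (min_le_left _ _))
        linarith

/-! ### Integrals along a regulated function -/

section Superposition

variable {E : Type*} [PseudoMetricSpace E] {x : ℝ → E} {k K : E → ℝ → ℝ} {h V m : ℝ → ℝ}
  {a b M : ℝ}

lemma tendsto_superposition (hc : ∀ s, ContinuousOn (fun y => k y s) (range x))
    {y : ℕ → ℝ → E} (hy : ∀ (j : ℕ) q, dist (y j q) (x q) ≤ 1 / ((j : ℝ) + 1) ∧ y j q ∈ range x)
    (s : ℝ) : Tendsto (fun j => k (y j s) s) atTop (𝓝 (k (x s) s)) := by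
  refine (hc s (x s) (mem_range_self s)).tendsto.comp (tendsto_nhdsWithin_iff.2
    ⟨?_, Eventually.of_forall fun j => (hy j s).2⟩)
  rw [tendsto_iff_dist_tendsto_zero]
  exact squeeze_zero (fun _ => dist_nonneg) (fun j => (hy j s).1)
    tendsto_one_div_add_atTop_nhds_zero_nat

/-- For a step function in place of `x` the integrand is piecewise some k(y, ·) with fixed y, hence
integrable. Uniform approximation of `x` by step functions and dominated convergence do the rest. -/
lemma exists_hasKS_superposition (hV : IsVariation h V) (hab : a ≤ b)
    (hl : ∀ t, ∃ l, Tendsto x (𝓝[<] t) (𝓝 l)) (hr : ∀ t, ∃ l, Tendsto x (𝓝[>] t) (𝓝 l))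
    (hc : ∀ s, ContinuousOn (fun y => k y s) (range x)) (hm : HasKS m V a b M)
    (hkm : ∀ y ∈ range x, ∀ s, |k y s| ≤ m s)
    (hk : ∀ y ∈ range x, ∃ I, HasKS (k y) h a b I) :
    ∃ I, HasKS (fun s => k (x s) s) h a b I := by
  choose y hy hy' using fun j : ℕ => exists_step_approx hl hr
    (show (0 : ℝ) < 1 / ((j : ℝ) + 1) by positivity) hab
    (fun y s t => ∃ I, HasKS (fun q => k (y q) q) h s t I)
    (fun t => ⟨0, HasGI.refl _ _⟩)
    (fun s t c y h1 h2 h3 h4 => by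
      obtain ⟨I, hI⟩ := hk (x c) (mem_range_self c)
      obtain ⟨J, hJ⟩ := HasGI.exists_subinterval hI h1 h2.le h3
      exact HasKS.exists_congr_Ioo hV hJ h2.le fun q hq => by rw [h4 q hq])
    (fun y₁ y₂ r s t _ h1 h2 _ H1 H2 => by
      obtain ⟨I, hI⟩ := H1
      obtain ⟨J, hJ⟩ := H2
      obtain ⟨K, hK⟩ := exists_hasKS_glue hV h1 h2 hI hJ
      refine ⟨K, hK.congr fun q _ => ?_⟩
      beta_reduce
      split_ifs <;> rfl)
  choose I hI using hy
  obtain ⟨L, hL, -⟩ := exists_hasKS_of_dominated hV hab hI hm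
    (fun j s => hkm _ (hy' j s).2 s) (tendsto_superposition hc hy')
  exact ⟨L, hL⟩

/-- A fine sum is nearly the integral of k(y(·), ·) for some `y` uniformly close to `x`. Here `y`
depends on the partition: it is frozen at x(τ) on intervals with an unexceptional tag and equals `x`
on those tagged in `Q`. No estimate of k(y, ·) - k(x, ·) is attempted at this stage. -/
lemma eventually_superposition_approx (hV : IsVariation h V)
    (hh : ∀ t, ContinuousWithinAt h (Iic t) t) (hab : a ≤ b)
    (hl : ∀ t, ∃ l, Tendsto x (𝓝[<] t) (𝓝 l)) (hr : ∀ t, ∃ l, Tendsto x (𝓝[>] t) (𝓝 l))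
    (hm : HasKS m V a b M) (hkm : ∀ y ∈ range x, ∀ s, |k y s| ≤ m s)
    (hK : ∀ y ∈ range x, ∀ s t, a ≤ s → s ≤ t → t ≤ b → HasKS (k y) h s t (K y t - K y s))
    {I : ℝ} (hI : HasKS (fun s => k (x s) s) h a b I) {ε : ℝ} (hε : 0 < ε) :
    ∀ᶠ l in fineFilter a b, ∃ y : ℝ → E, (∀ q, dist (y q) (x q) ≤ ε ∧ y q ∈ range x) ∧
      ∃ J, HasKS (fun q => k (y q) q) h a b J ∧
        |listSum (fun s τ t => K (x τ) t - K (x τ) s) l - J| ≤ ε := by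
  obtain ⟨Q, hQ, hosc⟩ := exists_finite_oscillation hl hr hε hab
  have hm0 : ∀ s, 0 ≤ m s := fun s => (abs_nonneg _).trans (hkm _ (mem_range_self s) s)
  obtain ⟨κ, hκ0, ⟨Kκ, hKκ, hκ⟩, η, hη, hκm⟩ :=
    exists_small_majorant hV.mono hab hm hm0 hQ (ε / 2) (half_pos hε)
  obtain ⟨W, -, hWb, hW⟩ := HasGI.exists_indefinite hab hκ
  obtain ⟨U, -, -, hU⟩ := HasGI.exists_indefinite hab hI
  have hδ : ∀ τ, ∃ δ > 0, τ ∈ Icc a b → τ ∉ Q → ∀ q, |q - τ| < δ → dist (x τ) (x q) ≤ ε := by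
    intro τ
    by_cases h1 : τ ∈ Icc a b ∧ τ ∉ Q
    · obtain ⟨δ, h2, h3⟩ := Metric.eventually_nhds_iff.1 (hosc τ h1.1 h1.2)
      exact ⟨δ, h2, fun _ _ q hq => h3 hq⟩
    · exact ⟨1, one_pos, fun h2 h3 => absurd ⟨h2, h3⟩ h1⟩
  choose δ hδ0 hδ using hδ
  refine eventually_fineFilter.2 ⟨fun τ => min (δ τ) η, fun τ => lt_min (hδ0 τ) hη, fun l hl => ?_⟩
  have key : ∀ a' l, FinePartition (fun τ => min (δ τ) η) a' b l → a ≤ a' →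
      ∃ y : ℝ → E, (∀ q, dist (y q) (x q) ≤ ε ∧ y q ∈ range x) ∧
      ∃ J, HasKS (fun q => k (y q) q) h a' b J ∧
        |listSum (fun s τ t => K (x τ) t - K (x τ) s) l - J| ≤ 2 * (W b - W a') := by
    intro a' l hl'
    clear hl
    induction hl' with
    | nil a' =>
      exact fun _ => ⟨x, fun q => ⟨by rw [dist_self]; exact hε.le, mem_range_self _⟩, 0,
        HasGI.refl _ _, by simp⟩
    | @cons a' b c τ l h1 h2 h3 h4 ih =>
      intro haa
      obtain ⟨y, hy, J, hJ, hJ'⟩ :=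
        ih hab hm hK hI hosc hκ hWb hW hU hδ (haa.trans h1.le)
      have hcb := h4.le
      have hτ : τ ∈ Icc a b := by rcases h2 with rfl | rfl <;> constructor <;> linarith
      have hWc : 0 ≤ W c - W a' :=
        HasKS.nonneg hV.mono h1.le (hW a' c haa h1.le hcb) fun s _ => hκ0 s
      obtain ⟨z, hz, Z, hZ, hZ'⟩ : ∃ z : ℝ → E, (∀ q, dist (z q) (x q) ≤ ε ∧ z q ∈ range x) ∧
          ∃ Z, HasKS (fun q => k (z q) q) h a' c Z ∧
            |K (x τ) c - K (x τ) a' - Z| ≤ 2 * (W c - W a') := by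
        have hnear : ∀ q ∈ Icc a' c, |q - τ| < min (δ τ) η := by
          intro q hq
          refine lt_of_le_of_lt ?_ h3
          rw [abs_le]
          rcases h2 with rfl | rfl <;> constructor <;> linarith [hq.1, hq.2]
        -- At a tag in `Q` the two integrands agree at τ itself and elsewhere differ by at most 2m ≤
        -- 2κ. At any other tag the summand is an exact integral, the value of `y` at the right
        -- endpoint being irrelevant by left-continuity of `h`.
        by_cases hτQ : τ ∈ Q
        · refine ⟨x, fun q => ⟨by rw [dist_self]; exact hε.le, mem_range_self _⟩, _,
            hU a' c haa h1.le hcb, ?_⟩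
          refine HasKS.abs_le hV h1.le
            ((hK (x τ) (mem_range_self τ) a' c haa h1.le hcb).sub (hU a' c haa h1.le hcb))
            (HasKS.const_mul 2 (hW a' c haa h1.le hcb)) fun s hs => ?_
          rcases eq_or_ne s τ with rfl | hsτ
          · rw [sub_self, abs_zero]
            linarith [hκ0 s]
          · have e1 := hκm τ hτQ s hsτ ((hnear s hs).trans_le (min_le_right _ _))
            have e2 := hkm (x τ) (mem_range_self τ) s
            have e3 := hkm (x s) (mem_range_self s) s
            refine (abs_sub _ _).trans ?_
            linarith
        · classical
          refine ⟨fun q => if q ∈ Ico a' c then x τ else x q, fun q => ?_, _,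
            (hK (x τ) (mem_range_self τ) a' c haa h1.le hcb).congr_Ico h1.le
              (fun q hq => by beta_reduce; rw [if_pos hq]) (hh c), ?_⟩
          · dsimp only
            split_ifs with hq
            · exact ⟨hδ τ hτ hτQ q ((hnear q ⟨hq.1, hq.2.le⟩).trans_le (min_le_left _ _)),
                mem_range_self _⟩
            · exact ⟨by rw [dist_self]; exact hε.le, mem_range_self _⟩
          · rw [sub_self, abs_zero]
            linarith
      refine ⟨fun q => if q < c then z q else y q, fun q => ?_, Z + J, ?_, ?_⟩
      · dsimp only
        split_ifs
        exacts [hz q, hy q]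
      · refine HasGI.trans h1.le hcb
          (hZ.congr_Ico h1.le (fun q hq => by beta_reduce; rw [if_pos hq.2]) (hh c))
          (hJ.congr fun q hq => by beta_reduce; rw [if_neg (not_lt.2 hq.1)])
      · rw [listSum_cons]
        rw [abs_le] at *
        constructor <;> linarith
  obtain ⟨y, hy, J, hJ, hJ'⟩ := key a l hl le_rfl
  refine ⟨y, hy, J, hJ, hJ'.trans ?_⟩
  have := HasGI.unique hab hκ (hW a b le_rfl hab le_rfl)
  linarith

/-- The Kurzweil integral of `D K(x(τ), t)`, for `K(y, ·)` an indefinite integral of `k(y, ·)`,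
is the integral of `s ↦ k(x(s), s)`. -/
theorem hasGI_superposition (hV : IsVariation h V)
    (hh : ∀ t, ContinuousWithinAt h (Iic t) t) (hab : a ≤ b)
    (hl : ∀ t, ∃ l, Tendsto x (𝓝[<] t) (𝓝 l)) (hr : ∀ t, ∃ l, Tendsto x (𝓝[>] t) (𝓝 l))
    (hc : ∀ s, ContinuousOn (fun y => k y s) (range x)) (hm : HasKS m V a b M)
    (hkm : ∀ y ∈ range x, ∀ s, |k y s| ≤ m s)
    (hK : ∀ y ∈ range x, ∀ s t, a ≤ s → s ≤ t → t ≤ b → HasKS (k y) h s t (K y t - K y s)) :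
    ∃ I, HasKS (fun s => k (x s) s) h a b I ∧
      HasGI (fun s τ t => K (x τ) t - K (x τ) s) a b I := by
  obtain ⟨I, hI⟩ := exists_hasKS_superposition hV hab hl hr hc hm hkm
    fun y hy => ⟨_, hK y hy a b le_rfl hab le_rfl⟩
  refine ⟨I, hI, Metric.tendsto_nhds.2 fun ε hε => ?_⟩
  -- Continuity of k(·, s) is not uniform in `s`, so the choice of tolerance is made by
  -- contradiction: bad partitions for the tolerances 1/(j+1) yield functions `y j` tending
  -- uniformly to `x`, and dominated convergence along them contradicts badness.
  by_contra hcon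
  have hj : ∀ j : ℕ, ∃ l, (∃ y : ℝ → E,
      (∀ q, dist (y q) (x q) ≤ 1 / ((j : ℝ) + 1) ∧ y q ∈ range x) ∧
      ∃ J, HasKS (fun q => k (y q) q) h a b J ∧
        |listSum (fun s τ t => K (x τ) t - K (x τ) s) l - J| ≤ 1 / ((j : ℝ) + 1)) ∧
      ¬ dist (listSum (fun s τ t => K (x τ) t - K (x τ) s) l) I < ε := fun j =>
    ((eventually_superposition_approx hV hh hab hl hr hm hkm hK hI
      (show (0 : ℝ) < 1 / ((j : ℝ) + 1) by positivity)).and_frequently (not_eventually.1 hcon)).exists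
  choose l hy hdist using hj
  choose y hy J hJ hJ' using hy
  obtain ⟨L, hL, hlim⟩ := exists_hasKS_of_dominated hV hab hJ hm
    (fun j s => hkm _ (hy j s).2 s) (tendsto_superposition hc hy)
  rw [HasGI.unique hab hL hI] at hlim
  have h0 : Tendsto (fun j => listSum (fun s τ t => K (x τ) t - K (x τ) s) (l j) - J j) atTop
      (𝓝 0) := squeeze_zero_norm hJ' tendsto_one_div_add_atTop_nhds_zero_nat
  have h1 := h0.add hlim
  simp only [sub_add_cancel, zero_add] at h1
  obtain ⟨j, hj⟩ := (Metric.tendsto_nhds.1 h1 ε hε).exists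
  exact hdist j hj

end Superposition

/-! ### Comparison with the Kurzweil integral over tagged partitions -/

section Comparison

variable {X : Type*} [NormedAddCommGroup X] {U : ℝ → ℝ → X} {a b : ℝ} {I : X}

lemma FinePartition.mono_Icc {δ δ' : ℝ → ℝ} {l : List (ℝ × ℝ × ℝ)} (H : FinePartition δ a b l)
    (hδ : ∀ t ∈ Icc a b, δ t ≤ δ' t) : FinePartition δ' a b l := by
  induction H with
  | nil a => exact .nil a
  | cons h1 h2 h3 h4 ih =>
    refine .cons h1 h2 (h3.trans_le (hδ _ ?_)) (ih fun t ht => hδ t ⟨h1.le.trans ht.1, ht.2⟩)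
    have := h4.le
    rcases h2 with rfl | rfl <;> constructor <;> linarith

lemma FinePartition.exists_taggedPartition {δ : ℝ → ℝ} {l : List (ℝ × ℝ × ℝ)}
    (H : FinePartition δ a b l) (U : ℝ → ℝ → X) :
    ∃ P : TaggedPartition a b, P.IsFine δ ∧
      P.kurzweilSum U = listSum (fun s τ t => U τ t - U τ s) l := by
  induction H with
  | nil a =>
    refine ⟨⟨0, fun _ => a, fun _ => a, rfl, rfl, fun j hj => absurd hj j.not_lt_zero,
      fun j hj => absurd hj j.not_lt_zero⟩, fun j hj => absurd hj j.not_lt_zero, ?_⟩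
    simp [TaggedPartition.kurzweilSum]
  | @cons a b c τ l h1 h2 h3 _ ih =>
    obtain ⟨P, hP, hU⟩ := ih
    have hτ : τ ∈ Icc a c := by rcases h2 with rfl | rfl <;> constructor <;> linarith
    refine ⟨⟨P.ν + 1, fun j => Nat.casesOn j a P.pt, fun j => Nat.casesOn j τ P.tag, rfl,
      P.pt_last, ?_, ?_⟩, ?_, ?_⟩
    · rintro (_ | j) hj
      · simpa [P.pt_zero] using hτ
      · exact P.tag_mem j (Nat.lt_of_succ_lt_succ hj)
    · rintro (_ | j) hj
      · simpa [P.pt_zero] using h1.le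
      · exact P.mono j (Nat.lt_of_succ_lt_succ hj)
    · rintro (_ | j) hj
      · show Icc a (P.pt 0) ⊆ Ioo (τ - δ τ) (τ + δ τ)
        rw [P.pt_zero]
        intro s hs
        rcases h2 with rfl | rfl <;> constructor <;> linarith [hs.1, hs.2]
      · exact hP j (Nat.lt_of_succ_lt_succ hj)
    · rw [listSum_cons, ← hU, TaggedPartition.kurzweilSum, Finset.sum_range_succ', add_comm]
      simp [TaggedPartition.kurzweilSum, P.pt_zero]

/-- Cutting [p, q] at its tag τ leaves the sum unchanged, because U(τ, q) - U(τ, p) = (U(τ, q) -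
U(τ, τ)) + (U(τ, τ) - U(τ, p)). Degenerate pieces contribute 0 and are dropped. -/
lemma TaggedPartition.IsFine.exists_finePartition {δ : ℝ → ℝ} {P : TaggedPartition a b}
    (hP : P.IsFine δ) (U : ℝ → ℝ → X) :
    ∃ l, FinePartition δ a b l ∧ listSum (fun s τ t => U τ t - U τ s) l = P.kurzweilSum U := by
  have piece : ∀ p τ q, τ ∈ Icc p q → Icc p q ⊆ Ioo (τ - δ τ) (τ + δ τ) →
      ∃ l, FinePartition δ p q l ∧ listSum (fun s τ t => U τ t - U τ s) l = U τ q - U τ p := by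
    intro p τ q hτ H
    have h1 := H (left_mem_Icc.2 (hτ.1.trans hτ.2))
    have h2 := H (right_mem_Icc.2 (hτ.1.trans hτ.2))
    have hl : ∃ l, FinePartition δ p τ l ∧
        listSum (fun s τ t => U τ t - U τ s) l = U τ τ - U τ p := by
      rcases hτ.1.eq_or_lt with rfl | h
      · exact ⟨[], .nil _, by simp⟩
      · exact ⟨_, .cons h (.inr rfl) (by linarith [h1.1]) (.nil τ), by simp⟩
    have hr : ∃ l, FinePartition δ τ q l ∧
        listSum (fun s τ t => U τ t - U τ s) l = U τ q - U τ τ := by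
      rcases hτ.2.eq_or_lt with rfl | h
      · exact ⟨[], .nil _, by simp⟩
      · exact ⟨_, .cons h (.inl rfl) (by linarith [h2.2]) (.nil q), by simp⟩
    obtain ⟨l₁, e1, f1⟩ := hl
    obtain ⟨l₂, e2, f2⟩ := hr
    refine ⟨l₁ ++ l₂, e1.append e2, ?_⟩
    rw [listSum_append, f1, f2]
    abel
  have key : ∀ n ≤ P.ν, ∃ l, FinePartition δ a (P.pt n) l ∧
      listSum (fun s τ t => U τ t - U τ s) l =
        ∑ j ∈ Finset.range n, (U (P.tag j) (P.pt (j + 1)) - U (P.tag j) (P.pt j)) := by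
    intro n
    induction n with
    | zero => exact fun _ => ⟨[], by rw [P.pt_zero]; exact .nil a, by simp⟩
    | succ n ih =>
      intro hn
      obtain ⟨l₁, e1, f1⟩ := ih (Nat.le_of_succ_le hn)
      obtain ⟨l₂, e2, f2⟩ := piece _ _ _ (P.tag_mem n hn) (hP n hn)
      exact ⟨l₁ ++ l₂, e1.append e2, by rw [listSum_append, f1, f2, Finset.sum_range_succ]⟩
  have := key P.ν le_rfl
  rwa [P.pt_last] at this

lemma hasKurzweilIntegral_iff :
    HasKurzweilIntegral U a b I ↔ HasGI (fun s τ t => U τ t - U τ s) a b I := by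
  constructor
  · intro H
    refine Metric.tendsto_nhds.2 fun ε hε => ?_
    obtain ⟨δ, h0, H⟩ := H ε hε
    classical
    refine eventually_fineFilter.2 ⟨fun τ => if τ ∈ Icc a b then δ τ else 1, fun τ => ?_,
      fun l hl => ?_⟩
    · beta_reduce
      split_ifs with h
      exacts [h0 τ h, one_pos]
    · obtain ⟨P, hP, hU⟩ := (hl.mono_Icc (δ' := δ)
        fun t ht => by rw [if_pos ht]).exists_taggedPartition U
      rw [dist_eq_norm, ← hU]
      exact H P hP
  · intro H ε hε
    obtain ⟨δ, h0, H⟩ := eventually_fineFilter.1 (Metric.tendsto_nhds.1 H ε hε)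
    refine ⟨δ, fun τ _ => h0 τ, fun P hP => ?_⟩
    obtain ⟨l, hl, hU⟩ := hP.exists_finePartition U
    rw [← hU, ← dist_eq_norm]
    exact H l hl

lemma kurzweilIntegral_eq (hab : a ≤ b) (H : HasKurzweilIntegral U a b I) :
    kurzweilIntegral U a b = I := by
  have h : KurzweilIntegrable U a b := ⟨I, H⟩
  rw [kurzweilIntegral, dif_pos h]
  exact (hasKurzweilIntegral_iff.1 h.choose_spec).unique hab (hasKurzweilIntegral_iff.1 H)

end Comparison

section Components

variable {n : ℕ} {a b : ℝ}

lemma hasGI_iff_apply {φ : ℝ → ℝ → ℝ → Rn n} {I : Rn n} :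
    HasGI φ a b I ↔ ∀ i, HasGI (fun s τ t => φ s τ t i) a b (I i) := by
  have h1 : ∀ i l, listSum (fun s τ t => φ s τ t i) l = listSum φ l i := fun i l =>
    listSum_map (⟨⟨fun y : Rn n => y i, rfl⟩, fun _ _ => rfl⟩ : Rn n →+ ℝ)
  unfold HasGI
  rw [(PiLp.homeomorph 1 fun _ : Fin n => ℝ).isInducing.tendsto_nhds_iff, tendsto_pi_nhds]
  refine forall_congr' fun i => tendsto_congr fun l => ?_
  exact (h1 i l).symm

lemma hasKurzweilIntegral_smul_iff {u : ℝ → Rn n} {h : ℝ → ℝ} {I : Rn n} :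
    HasKurzweilIntegral (fun τ t => h t • u τ) a b I ↔
      ∀ i, HasKS (fun s => u s i) h a b (I i) := by
  rw [hasKurzweilIntegral_iff, hasGI_iff_apply]
  have : ∀ i, (fun s τ t => (h t • u τ - h s • u τ) i) =
      fun (s τ t : ℝ) => u τ i * (h t - h s) := fun i => by
    ext s τ t
    simp only [PiLp.sub_apply, PiLp.smul_apply, smul_eq_mul]
    ring
  simp only [this]
  rfl

lemma ksIntegrable_iff {u : ℝ → Rn n} {h : ℝ → ℝ} :
    KSIntegrable u h a b ↔ ∀ i, ∃ I, HasKS (fun s => u s i) h a b I := by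
  unfold KSIntegrable KurzweilIntegrable
  simp only [hasKurzweilIntegral_smul_iff]
  constructor
  · exact fun ⟨I, hI⟩ i => ⟨_, hI i⟩
  · intro H
    choose I hI using H
    exact ⟨WithLp.toLp 1 I, hI⟩

lemma ksIntegral_apply (hab : a ≤ b) {u : ℝ → Rn n} {h : ℝ → ℝ} {I : Rn n}
    (H : ∀ i, HasKS (fun s => u s i) h a b (I i)) : ksIntegral u h a b = I :=
  kurzweilIntegral_eq hab (hasKurzweilIntegral_smul_iff.2 H)

lemma exists_hasKS_of_ksIntegrable {u h : ℝ → ℝ} (H : KSIntegrable u h a b) :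
    ∃ I, HasKS u h a b I := by
  obtain ⟨I, hI⟩ := H
  refine ⟨I, (hasKurzweilIntegral_iff.1 hI).congr fun s τ t _ _ _ _ => ?_⟩
  simp only [smul_eq_mul]
  ring

end Components

/-! ### Lebesgue integrable functions -/

/-- By the Vitali-Carathéodory theorem there is a lower semicontinuous g > u with nearly the same
integral. Semicontinuity provides the gauge: u(τ) < g near τ, so each term is at most the integral
of g over its interval. Applying this to -u as well gives the two-sided estimate. -/
lemma eventually_listSum_le_integral {u : ℝ → ℝ} {a b : ℝ} (hab : a ≤ b)
    (hu : IntegrableOn u (Icc a b)) {ε : ℝ} (hε : 0 < ε) :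
    ∀ᶠ l in fineFilter a b, listSum (fun s τ t => u τ * (t - s)) l ≤ (∫ s in a..b, u s) + ε := by
  obtain ⟨g, hug, hg, hgi, hgt, hgu⟩ := exists_lt_lowerSemicontinuous_integral_lt u hu hε
  have hδ : ∀ τ, ∃ δ > 0, ∀ s, |s - τ| < δ → (u τ : EReal) < g s := fun τ =>
    Metric.eventually_nhds_iff.1 (hg τ _ (hug τ))
  choose δ hδ0 hδ using hδ
  refine eventually_fineFilter.2 ⟨δ, hδ0, fun l hl => ?_⟩
  have key : ∀ a' l, FinePartition δ a' b l → a ≤ a' →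
      listSum (fun s τ t => u τ * (t - s)) l ≤ ∫ s in a'..b, (g s).toReal := by
    intro a' l hl'
    clear hl
    induction hl' with
    | nil a => exact fun _ => by simp
    | @cons a' b c τ l h1 h2 h3 h4 ih =>
      intro haa
      have hcb := h4.le
      have hint : ∀ s t, a ≤ s → s ≤ t → t ≤ b →
          IntervalIntegrable (fun s => (g s).toReal) volume s t := by
        intro s t e1 e2 e3
        rw [intervalIntegrable_iff_integrableOn_Icc_of_le e2]
        exact IntegrableOn.mono_set hgi (Icc_subset_Icc e1 e3)
      rw [listSum_cons, ← intervalIntegral.integral_add_adjacent_intervals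
        (hint a' c haa h1.le hcb) (hint c b (haa.trans h1.le) hcb le_rfl)]
      refine add_le_add ?_ (ih hab hu hgi hgt hgu (haa.trans h1.le))
      have e : u τ * (c - a') = ∫ _ in a'..c, u τ := by
        rw [intervalIntegral.integral_const, smul_eq_mul, mul_comm]
      rw [e]
      refine intervalIntegral.integral_mono_ae_restrict h1.le (by simp)
        (hint a' c haa h1.le hcb) ?_
      have hsub : Icc a' c ⊆ Icc a b := Icc_subset_Icc haa hcb
      filter_upwards [ae_mono (Measure.restrict_mono hsub le_rfl) hgt,
        ae_restrict_mem measurableSet_Icc] with s hs hs'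
      have h5 : (u τ : EReal) < g s := hδ τ s <| by
        refine lt_of_le_of_lt ?_ h3
        rw [abs_le]
        rcases h2 with rfl | rfl <;> constructor <;> linarith [hs'.1, hs'.2]
      exact EReal.coe_le_coe_iff.1 (by
        rw [EReal.coe_toReal hs.ne ((EReal.bot_lt_coe _).trans h5).ne']; exact h5.le)
  refine (key a l hl le_rfl).trans ?_
  rw [intervalIntegral.integral_of_le hab, intervalIntegral.integral_of_le hab,
    ← integral_Icc_eq_integral_Ioc, ← integral_Icc_eq_integral_Ioc]
  exact hgu.le

/-- Lebesgue integrable functions are Henstock-Kurzweil integrable. -/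
lemma hasKS_id_of_integrableOn {u : ℝ → ℝ} {a b : ℝ} (hab : a ≤ b)
    (hu : IntegrableOn u (Icc a b)) : HasKS u id a b (∫ s in a..b, u s) := by
  refine Metric.tendsto_nhds.2 fun ε hε => ?_
  filter_upwards [eventually_listSum_le_integral hab hu (half_pos hε),
    eventually_listSum_le_integral hab hu.neg (half_pos hε)] with l h1 h2
  have h3 : listSum (fun s τ t => (-u) τ * (t - s)) l = -listSum (fun s τ t => u τ * (t - s)) l := by
    rw [← neg_one_mul (listSum _ l), ← listSum_mul_left]
    exact listSum_congr fun p _ => by simp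
  rw [h3] at h2
  simp only [Pi.neg_apply, intervalIntegral.integral_neg] at h2
  simp only [id]
  rw [Real.dist_eq, abs_lt]
  constructor <;> linarith

/-! ### Jumps of an indefinite integral -/

section Jumps

variable {u h G : ℝ → ℝ} {a b : ℝ}

/-- The Saks-Henstock lemma bounds the error of the single interval [a, t] tagged at `a`. This is
the jump formula G(a+) - G(a) = u(a)(h(a+) - h(a)), in a form that does not presuppose the limits.
-/
lemma tendsto_indefinite_right
    (hG : ∀ s t, a ≤ s → s ≤ t → t ≤ b → HasKS u h s t (G t - G s)) (hab : a < b) :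
    Tendsto (fun t => G t - G a - u a * (h t - h a)) (𝓝[>] a) (𝓝 0) := by
  refine Metric.tendsto_nhds.2 fun ε hε => ?_
  obtain ⟨δ, h0, H⟩ := eventually_fineFilter.1 (saks_henstock hG hab.le (half_pos hε))
  filter_upwards [Ioo_mem_nhdsGT (lt_min hab (lt_add_of_pos_right a (h0 a)))] with t ht
  have htb : t < b := ht.2.trans_le (min_le_left _ _)
  have htδ : t < a + δ a := ht.2.trans_le (min_le_right _ _)
  obtain ⟨l, hl⟩ := exists_finePartition h0 htb.le
  have := H _ (.cons ht.1 (.inl rfl) (by linarith) hl)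
  rw [listSum_cons] at this
  have h2 := listSum_nonneg (l := l) (φ := fun s τ t => |u τ * (h t - h s) - (G t - G s)|)
    fun _ _ => abs_nonneg _
  rw [Real.dist_eq, sub_zero, abs_sub_comm]
  linarith

lemma tendsto_indefinite_left
    (hG : ∀ s t, a ≤ s → s ≤ t → t ≤ b → HasKS u h s t (G t - G s)) (hab : a < b) :
    Tendsto (fun s => G b - G s - u b * (h b - h s)) (𝓝[<] b) (𝓝 0) := by
  refine Metric.tendsto_nhds.2 fun ε hε => ?_
  obtain ⟨δ, h0, H⟩ := eventually_fineFilter.1 (saks_henstock hG hab.le (half_pos hε))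
  filter_upwards [Ioo_mem_nhdsLT (max_lt hab (sub_lt_self b (h0 b)))] with t ht
  have hat : a < t := (le_max_left _ _).trans_lt ht.1
  have htδ : b - δ b < t := (le_max_right _ _).trans_lt ht.1
  obtain ⟨l, hl⟩ := exists_finePartition h0 hat.le
  have := H _ (hl.append (.cons ht.2 (.inr rfl) (by linarith) (.nil b)))
  rw [listSum_append, listSum_cons, listSum_nil, add_zero] at this
  have h2 := listSum_nonneg (l := l) (φ := fun s τ t => |u τ * (h t - h s) - (G t - G s)|)
    fun _ _ => abs_nonneg _
  rw [Real.dist_eq, sub_zero, abs_sub_comm]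
  linarith

lemma continuousWithinAt_indefinite
    (hG : ∀ s t, a ≤ s → s ≤ t → t ≤ b → HasKS u h s t (G t - G s)) (hab : a < b)
    (hh : ContinuousWithinAt h (Iic b) b) : ContinuousWithinAt G (Iic b) b := by
  have h1 := tendsto_indefinite_left hG hab
  have h2 : Tendsto h (𝓝[<] b) (𝓝 (h b)) :=
    hh.mono_left (nhdsWithin_mono _ Iio_subset_Iic_self)
  have h3 := ((h2.const_sub (h b)).const_mul (u b)).add h1
  rw [← continuousWithinAt_Iio_iff_Iic]
  have h4 := h3.const_sub (G b)
  simp only [sub_self, mul_zero, add_zero, sub_zero] at h4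
  refine h4.congr fun s => ?_
  ring

end Jumps

/-! ### One-dimensional distributions -/

lemma BoundedVariationOn.intervalIntegrable_real {u : ℝ → ℝ} {a b : ℝ} (hab : a ≤ b)
    (H : BoundedVariationOn u (Icc a b)) : IntervalIntegrable u volume a b := by
  obtain ⟨p, q, hp, hq, e⟩ := H.locallyBoundedVariationOn.exists_monotoneOn_sub_monotoneOn
  rw [← uIcc_of_le hab] at hp hq
  rw [e]
  exact hp.intervalIntegrable.sub hq.intervalIntegrable

lemma integral_primitive_mul_deriv {u φ : ℝ → ℝ} {T : ℝ}
    (hu : IntervalIntegrable u volume 0 T) (hφ : ContDiff ℝ ∞ φ) (h0 : φ 0 = 0) (hT : φ T = 0) :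
    ∫ t in (0 : ℝ)..T, (∫ s in (0 : ℝ)..t, u s) * deriv φ t = -∫ t in (0 : ℝ)..T, u t * φ t := by
  have h1 := hu.absolutelyContinuousOnInterval_intervalIntegral (left_mem_uIcc (a := 0) (b := T))
  have h2 : AbsolutelyContinuousOnInterval φ 0 T :=
    (hφ.of_le (by exact_mod_cast le_top)).contDiffOn.absolutelyContinuousOnInterval
  rw [h1.integral_mul_deriv_eq_deriv_mul h2, h0, hT, mul_zero, mul_zero, sub_zero, zero_sub,
    neg_inj]
  refine intervalIntegral.integral_congr_ae ?_
  filter_upwards [hu.ae_hasDerivAt_integral] with t ht ht'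
  rw [(ht (uIoc_subset_uIcc ht') 0 left_mem_uIcc).deriv]

lemma integral_deriv_eq_zero {φ : ℝ → ℝ} {T : ℝ} (hφ : ContDiff ℝ ∞ φ) (h0 : φ 0 = 0)
    (hT : φ T = 0) : ∫ t in (0 : ℝ)..T, deriv φ t = 0 := by
  rw [intervalIntegral.integral_deriv_eq_sub, h0, hT, sub_zero]
  · exact fun t _ => (hφ.differentiable (by simp)).differentiableAt
  · exact (hφ.continuous_deriv (by exact_mod_cast le_top)).intervalIntegrable _ _

/-- A smooth function of integral zero and compact support in `(0, T)` is the derivative of a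
test function. -/
lemma exists_primitive_testFun {χ : ℝ → ℝ} {T : ℝ} (hχ : ContDiff ℝ ∞ χ)
    (hsupp : tsupport χ ⊆ Ioo 0 T) (hint : ∫ t in (0 : ℝ)..T, χ t = 0) :
    ∃ φ : ℝ → ℝ, ContDiff ℝ ∞ φ ∧ (∀ j t, t ∉ Ioo 0 T → iteratedDeriv j φ t = 0) ∧
      deriv φ = χ := by
  have hd : ∀ t, HasDerivAt (fun t => ∫ s in (0 : ℝ)..t, χ s) (χ t) t := fun t =>
    intervalIntegral.integral_hasDerivAt_right (hχ.continuous.intervalIntegrable _ _)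
      hχ.continuous.aestronglyMeasurable.stronglyMeasurableAtFilter hχ.continuous.continuousAt
  have hderiv : deriv (fun t => ∫ s in (0 : ℝ)..t, χ s) = χ := funext fun t => (hd t).deriv
  have h0 : ∀ t, t ∉ Ioo 0 T → χ t = 0 := fun t ht =>
    image_eq_zero_of_notMem_tsupport fun h => ht (hsupp h)
  refine ⟨_, contDiff_infty_iff_deriv.2 ⟨fun t => (hd t).differentiableAt, by rwa [hderiv]⟩, ?_,
    hderiv⟩
  rintro (_ | j) t ht
  · rw [iteratedDeriv_zero]
    rcases le_or_gt t 0 with h | h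
    · rw [intervalIntegral.integral_congr (g := fun _ => (0 : ℝ)), intervalIntegral.integral_zero]
      intro s hs
      rw [uIcc_of_ge h] at hs
      exact h0 s fun h' => absurd h'.1 (not_lt.2 hs.2)
    · have hTt : T ≤ t := not_lt.1 fun h' => ht ⟨h, h'⟩
      rw [← intervalIntegral.integral_add_adjacent_intervals
        (hχ.continuous.intervalIntegrable 0 T) (hχ.continuous.intervalIntegrable T t), hint,
        zero_add, intervalIntegral.integral_congr (g := fun _ => (0 : ℝ)),
        intervalIntegral.integral_zero]
      intro s hs
      rw [uIcc_of_le hTt] at hs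
      exact h0 s fun h' => absurd h'.2 (not_lt.2 hs.1)
  · rw [iteratedDeriv_succ', hderiv, ← norm_eq_zero, ← norm_iteratedFDeriv_eq_norm_iteratedDeriv,
      norm_eq_zero]
    by_contra hne
    exact ht (hsupp (support_iteratedFDeriv_subset j hne))

/-- The **du Bois-Reymond lemma**. -/
lemma ae_eq_const_of_integral_mul_deriv_eq_zero {w : ℝ → ℝ} {T : ℝ} (hT : 0 < T)
    (hw : IntervalIntegrable w volume 0 T)
    (H : ∀ φ : ℝ → ℝ, ContDiff ℝ ∞ φ → (∀ j t, t ∉ Ioo 0 T → iteratedDeriv j φ t = 0) →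
      ∫ t in (0 : ℝ)..T, w t * deriv φ t = 0) :
    ∃ c, ∀ᵐ t, t ∈ Ioo 0 T → w t = c := by
  let η : ContDiffBump (T / 2) := ⟨T / 8, T / 4, by positivity, by linarith⟩
  set ρ : ℝ → ℝ := η.normed volume with hρ
  have hρd : ContDiff ℝ ∞ ρ := η.contDiff_normed
  have hρs : tsupport ρ ⊆ Ioo 0 T := by
    rw [hρ, η.tsupport_normed_eq, Real.closedBall_eq_Icc]
    intro t ht
    have h1 : T / 2 - T / 4 ≤ t := ht.1
    have h2 : t ≤ T / 2 + T / 4 := ht.2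
    constructor <;> linarith
  have hset : ∀ F : ℝ → ℝ, (∀ t, t ∉ Ioo 0 T → F t = 0) → ∫ t, F t = ∫ t in (0 : ℝ)..T, F t := by
    intro F hF
    rw [intervalIntegral.integral_of_le hT.le, ← integral_Ioc_eq_integral_Ioo.symm]
    exact (setIntegral_eq_integral_of_forall_compl_eq_zero hF).symm
  have hρ1 : ∫ t in (0 : ℝ)..T, ρ t = 1 := by
    rw [← hset ρ fun t ht => image_eq_zero_of_notMem_tsupport fun h => ht (hρs h)]
    exact η.integral_normed
  -- For any ψ the function ψ - (∫ψ)ρ has integral zero and so is the derivative of a test function.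
  -- The hypothesis then reads ∫ wψ = (∫ψ)C, which says that w - C annihilates ψ.
  set C := ∫ t in (0 : ℝ)..T, w t * ρ t with hC
  refine ⟨C, ?_⟩
  have hwc : IntervalIntegrable (fun t => w t - C) volume 0 T :=
    hw.sub intervalIntegrable_const
  have hloc : LocallyIntegrableOn (fun t => w t - C) (Ioo 0 T) :=
    (((intervalIntegrable_iff_integrableOn_Ioc_of_le hT.le).1 hwc).mono_set
      Ioo_subset_Ioc_self).locallyIntegrableOn
  have key := isOpen_Ioo.ae_eq_zero_of_integral_contDiff_smul_eq_zero hloc (μ := volume)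
    fun ψ hψ _ hψs => ?_
  · filter_upwards [key] with t ht ht'
    exact sub_eq_zero.1 (ht ht')
  · have hψ0 : ∀ t, t ∉ Ioo 0 T → ψ t = 0 := fun t ht =>
      image_eq_zero_of_notMem_tsupport fun h => ht (hψs h)
    rw [hset _ fun t ht => by rw [hψ0 t ht, zero_smul]]
    set c := ∫ t in (0 : ℝ)..T, ψ t with hc
    have i1 : ∀ {F : ℝ → ℝ}, ContDiff ℝ ∞ F → IntervalIntegrable F volume 0 T := fun hF =>
      hF.continuous.intervalIntegrable _ _
    have i2 : ∀ {F : ℝ → ℝ}, ContDiff ℝ ∞ F → IntervalIntegrable (fun t => w t * F t) volume 0 T :=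
      fun hF => hw.mul_continuousOn hF.continuous.continuousOn
    have hcρ : ContDiff ℝ ∞ fun t => c * ρ t := contDiff_const.mul hρd
    obtain ⟨φ, h1, h2, h3⟩ := exists_primitive_testFun (χ := fun t => ψ t - c * ρ t)
      (hψ.sub hcρ) (by
        refine (closure_mono fun t ht => ?_).trans
          ((closure_union (s := Function.support ψ) (t := Function.support ρ)).subset.trans
            (union_subset hψs hρs))
        by_contra hcon
        simp only [mem_union, Function.mem_support, not_or, not_not] at hcon
        exact ht (by simp [hcon.1, hcon.2])) (by
        rw [intervalIntegral.integral_sub (i1 hψ) (i1 hcρ), intervalIntegral.integral_const_mul,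
          hρ1, mul_one, sub_self])
    have h4 := H φ h1 h2
    rw [h3] at h4
    have h5 : ∫ t in (0 : ℝ)..T, w t * (ψ t - c * ρ t) =
        (∫ t in (0 : ℝ)..T, w t * ψ t) - c * C := by
      rw [hC, ← intervalIntegral.integral_const_mul, ← intervalIntegral.integral_sub (i2 hψ)
        ((i2 hρd).const_mul c)]
      refine intervalIntegral.integral_congr fun t _ => ?_
      ring
    have h6 : ∫ t in (0 : ℝ)..T, ψ t • (w t - C) = (∫ t in (0 : ℝ)..T, w t * ψ t) - C * c := by
      rw [hc, ← intervalIntegral.integral_const_mul, ← intervalIntegral.integral_sub (i2 hψ)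
        ((i1 hψ).const_mul C)]
      refine intervalIntegral.integral_congr fun t _ => ?_
      simp only [smul_eq_mul]
      ring
    rw [h6, mul_comm C c, ← h5, h4]

/-- Every left neighbourhood of `t` has positive measure and so contains points where `w` takes the
value `c`. This also reaches t = T. -/
lemma eq_const_of_ae_of_leftContinuous {w : ℝ → ℝ} {T c : ℝ}
    (hw : ∀ t ∈ Ioc 0 T, ContinuousWithinAt w (Iic t) t)
    (H : ∀ᵐ t, t ∈ Ioo 0 T → w t = c) : ∀ t ∈ Ioc 0 T, w t = c := by
  intro t ht
  have h1 : Tendsto w (𝓝[<] t) (𝓝 (w t)) :=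
    (hw t ht).mono_left (nhdsWithin_mono _ Iio_subset_Iic_self)
  refine isClosed_singleton.mem_of_frequently_of_tendsto (s := {c}) ?_ h1
  rw [frequently_iff]
  intro U hU
  obtain ⟨η, hη, hU⟩ := mem_nhdsLT_iff_exists_Ioo_subset.1 hU
  have h2 : max η 0 < t := max_lt hη ht.1
  have h3 : ∃ᵐ s ∂volume, s ∈ Ioo (max η 0) t := by
    rw [frequently_ae_mem_iff, Real.volume_Ioo]
    simpa using h2
  obtain ⟨s, hs, hs'⟩ := (h3.and_eventually H).exists
  exact ⟨s, hU ⟨(le_max_left _ _).trans_lt hs.1, hs.2⟩,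
    hs' ⟨(le_max_right _ _).trans_lt hs.1, hs.2.trans_le ht.2⟩⟩

/-! ### Test functions and components -/

section Components

variable {n : ℕ} {T : ℝ}

lemma TestFun.apply_zero (φ : TestFun n T) : φ.toFun 0 = 0 := by
  simpa using φ.vanish 0 0 (by simp)

lemma TestFun.apply_right (φ : TestFun n T) : φ.toFun T = 0 := by
  simpa using φ.vanish 0 T (by simp)

lemma TestFun.contDiff_apply (φ : TestFun n T) (i : Fin n) : ContDiff ℝ ∞ fun t => φ.toFun t i :=
  (PiLp.proj (𝕜 := ℝ) 1 (fun _ : Fin n => ℝ) i).contDiff.comp φ.smooth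

lemma TestFun.derivative_apply (φ : TestFun n T) (i : Fin n) (t : ℝ) :
    φ.derivative.toFun t i = deriv (fun t => φ.toFun t i) t := by
  have h1 := ((φ.smooth.differentiable (by simp)) t).hasDerivAt
  have h2 := (PiLp.proj (𝕜 := ℝ) 1 (fun _ : Fin n => ℝ) i).hasFDerivAt.comp_hasDerivAt t h1
  exact h2.deriv.symm

/-- The test function with a single component. -/
noncomputable def TestFun.single (i : Fin n) (φ : ℝ → ℝ) (hφ : ContDiff ℝ ∞ φ)
    (h : ∀ j t, t ∉ Ioo 0 T → iteratedDeriv j φ t = 0) : TestFun n T where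
  toFun t := φ t • PiLp.single 1 i (1 : ℝ)
  smooth := hφ.smul contDiff_const
  vanish j t ht := by
    rw [iteratedDeriv_smul_const (hφ.contDiffAt.of_le (by exact_mod_cast le_top)), h j t ht,
      zero_smul]

lemma TestFun.single_apply (i j : Fin n) (φ : ℝ → ℝ) (hφ : ContDiff ℝ ∞ φ)
    (h : ∀ j t, t ∉ Ioo 0 T → iteratedDeriv j φ t = 0) (t : ℝ) :
    (TestFun.single i φ hφ h).toFun t j = if j = i then φ t else 0 := by
  simp [TestFun.single]

lemma ofFun_eq_sum {u : ℝ → Rn n} (hu : ∀ i, IntervalIntegrable (fun t => u t i) volume 0 T)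
    (φ : TestFun n T) : ofFun T u φ = ∑ i, ∫ t in (0 : ℝ)..T, u t i * φ.toFun t i := by
  unfold ofFun
  rw [intervalIntegral.integral_finsetSum]
  exact fun i _ => (hu i).mul_continuousOn (φ.contDiff_apply i).continuous.continuousOn

lemma distDeriv_ofFun_eq_sum {u : ℝ → Rn n}
    (hu : ∀ i, IntervalIntegrable (fun t => u t i) volume 0 T) (φ : TestFun n T) :
    distDeriv (ofFun T u) φ =
      -∑ i, ∫ t in (0 : ℝ)..T, u t i * deriv (fun t => φ.toFun t i) t := by
  unfold distDeriv
  rw [ofFun_eq_sum hu]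
  simp only [TestFun.derivative_apply]

end Components

/-! ### Extension from `[0, T]` to the line -/

/-- The retraction of the line onto `[0, T]`. -/
def clamp (T t : ℝ) : ℝ := max 0 (min t T)

section Clamp

variable {T t : ℝ}

lemma clamp_mem (hT : 0 ≤ T) (t : ℝ) : clamp T t ∈ Icc 0 T :=
  ⟨le_max_left _ _, max_le hT (min_le_right _ _)⟩

lemma clamp_of_mem (ht : t ∈ Icc 0 T) : clamp T t = t := by
  rw [clamp, min_eq_left ht.2, max_eq_right ht.1]

lemma clamp_of_nonpos (ht : t ≤ 0) : clamp T t = 0 :=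
  max_eq_left ((min_le_left _ _).trans ht)

lemma clamp_of_ge (hT : 0 ≤ T) (ht : T ≤ t) : clamp T t = T := by
  rw [clamp, min_eq_right ht, max_eq_right hT]

lemma monotone_clamp (T : ℝ) : Monotone (clamp T) := fun _ _ h =>
  max_le_max le_rfl (min_le_min h le_rfl)

lemma continuous_clamp (T : ℝ) : Continuous (clamp T) := by
  unfold clamp
  fun_prop

lemma RegulatedOn.exists_tendsto_left {X : Type*} [TopologicalSpace X] {x : ℝ → X} (hT : 0 ≤ T)
    (hx : RegulatedOn x T) (t : ℝ) :
    ∃ l, Tendsto (fun s => x (clamp T s)) (𝓝[<] t) (𝓝 l) := by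
  rcases le_or_gt t 0 with h | h
  · refine ⟨x 0, tendsto_nhds_of_eventually_eq ?_⟩
    filter_upwards [self_mem_nhdsWithin] with s hs
    rw [clamp_of_nonpos ((mem_Iio.1 hs).le.trans h)]
  rcases le_or_gt t T with h' | h'
  · obtain ⟨l, hl⟩ := hx.1 t ⟨h, h'⟩
    refine ⟨l, hl.congr' ?_⟩
    filter_upwards [Ioo_mem_nhdsLT h] with s hs
    rw [clamp_of_mem ⟨hs.1.le, hs.2.le.trans h'⟩]
  · refine ⟨x T, tendsto_nhds_of_eventually_eq ?_⟩
    filter_upwards [Ioo_mem_nhdsLT h'] with s hs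
    rw [clamp_of_ge hT hs.1.le]

lemma RegulatedOn.exists_tendsto_right {X : Type*} [TopologicalSpace X] {x : ℝ → X} (hT : 0 ≤ T)
    (hx : RegulatedOn x T) (t : ℝ) :
    ∃ l, Tendsto (fun s => x (clamp T s)) (𝓝[>] t) (𝓝 l) := by
  rcases lt_or_ge t 0 with h | h
  · refine ⟨x 0, tendsto_nhds_of_eventually_eq ?_⟩
    filter_upwards [Ioo_mem_nhdsGT h] with s hs
    rw [clamp_of_nonpos hs.2.le]
  rcases lt_or_ge t T with h' | h'
  · obtain ⟨l, hl⟩ := hx.2 t ⟨h, h'⟩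
    refine ⟨l, hl.congr' ?_⟩
    filter_upwards [Ioo_mem_nhdsGT h'] with s hs
    rw [clamp_of_mem ⟨h.trans hs.1.le, hs.2.le⟩]
  · refine ⟨x T, tendsto_nhds_of_eventually_eq ?_⟩
    filter_upwards [self_mem_nhdsWithin] with s hs
    rw [clamp_of_ge hT (h'.trans (mem_Ioi.1 hs).le)]

end Clamp

lemma HasKS.congr_integrator {u v h h' : ℝ → ℝ} {a b I : ℝ} (H : HasKS u h a b I)
    (e : ∀ s ∈ Icc a b, u s = v s) (e' : ∀ s ∈ Icc a b, h s = h' s) : HasKS v h' a b I := by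
  refine HasGI.congr H fun s τ t h1 h2 h3 h4 => ?_
  rw [e τ (by rcases h4 with rfl | rfl <;> constructor <;> linarith),
    e' s ⟨h1, h2.le.trans h3⟩, e' t ⟨h1.trans h2.le, h3⟩]

/-! ### Vector-valued integrals -/

section Vector

variable {n : ℕ} {T : ℝ}

lemma tendsto_Rn_iff {α : Type*} {l : Filter α} {F : α → Rn n} {y : Rn n} :
    Tendsto F l (𝓝 y) ↔ ∀ i, Tendsto (fun t => F t i) l (𝓝 (y i)) := by
  rw [(PiLp.homeomorph 1 fun _ : Fin n => ℝ).isInducing.tendsto_nhds_iff, tendsto_pi_nhds]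
  rfl

lemma hasKS_ksIntegral {u : ℝ → Rn n} {h : ℝ → ℝ} (hT : 0 ≤ T) (H : KSIntegrable u h 0 T) :
    ksIntegral u h 0 0 = 0 ∧ ∀ i s t, 0 ≤ s → s ≤ t → t ≤ T →
      HasKS (fun r => u r i) h s t (ksIntegral u h 0 t i - ksIntegral u h 0 s i) := by
  have h1 : ∀ i, ∃ G : ℝ → ℝ, G 0 = 0 ∧ ∀ s t, 0 ≤ s → s ≤ t → t ≤ T →
      HasKS (fun r => u r i) h s t (G t - G s) := by
    intro i
    obtain ⟨I, hI⟩ := ksIntegrable_iff.1 H i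
    obtain ⟨G, h0, -, hG⟩ := HasGI.exists_indefinite hT hI
    exact ⟨G, h0, hG⟩
  choose G h0 hG using h1
  have h2 : ∀ t ∈ Icc 0 T, ksIntegral u h 0 t = WithLp.toLp 1 fun i => G i t := by
    intro t ht
    refine ksIntegral_apply ht.1 fun i => ?_
    have := hG i 0 t le_rfl ht.1 ht.2
    rwa [h0, sub_zero] at this
  refine ⟨?_, fun i s t hs hst ht => ?_⟩
  · rw [h2 0 ⟨le_rfl, hT⟩]
    ext i
    exact h0 i
  · rw [h2 s ⟨hs, hst.trans ht⟩, h2 t ⟨hs.trans hst, ht⟩]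
    exact hG i s t hs hst ht

lemma integrableOn_apply {u : ℝ → Rn n} {s : Set ℝ} (hu : IntegrableOn u s) (i : Fin n) :
    IntegrableOn (fun t => u t i) s :=
  (PiLp.proj (𝕜 := ℝ) 1 (fun _ : Fin n => ℝ) i).integrable_comp hu

lemma ksIntegral_id_apply {u : ℝ → Rn n} (hu : IntegrableOn u (Icc 0 T)) {s : ℝ}
    (hs : s ∈ Icc 0 T) (i : Fin n) :
    ksIntegral u id 0 s i = ∫ t in (0 : ℝ)..s, u t i := by
  rw [ksIntegral_apply (I := WithLp.toLp 1 fun i => ∫ t in (0 : ℝ)..s, u t i) hs.1 fun i =>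
    hasKS_id_of_integrableOn hs.1
      ((integrableOn_apply hu i).mono_set (Icc_subset_Icc le_rfl hs.2))]

lemma ksIntegrable_id {u : ℝ → Rn n} (hT : 0 ≤ T) (hu : IntegrableOn u (Icc 0 T)) :
    KSIntegrable u id 0 T :=
  ksIntegrable_iff.2 fun i => ⟨_, hasKS_id_of_integrableOn hT (integrableOn_apply hu i)⟩

/-- Superposition of a dominated function with a regulated function on `[0, T]`. -/
theorem hasKurzweilIntegral_superposition (hT : 0 ≤ T) {Ω : Set (Rn n)} {k : Rn n → ℝ → Rn n}
    {x : ℝ → Rn n} {h h₀ V m : ℝ → ℝ} {M : ℝ} (hV : IsVariation h V)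
    (hh : ∀ t, ContinuousWithinAt h (Iic t) t) (e : ∀ s ∈ Icc 0 T, h s = h₀ s)
    (hx : RegulatedOn x T) (hxΩ : ∀ t ∈ Icc 0 T, x t ∈ Ω)
    (hc : ∀ t ∈ Icc 0 T, ContinuousOn (fun y => k y t) Ω) (hm : HasKS m V 0 T M)
    (hkm : ∀ y ∈ Ω, ∀ t ∈ Icc 0 T, ‖k y t‖ ≤ m t) (hk : ∀ y ∈ Ω, KSIntegrable (k y) h₀ 0 T) :
    KSIntegrable (fun s => k (x s) s) h₀ 0 T ∧
    (∀ s ∈ Icc 0 T, HasKurzweilIntegral (fun τ t => ksIntegral (k (x τ)) h₀ 0 t) 0 s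
      (ksIntegral (fun s => k (x s) s) h₀ 0 s)) ∧
    ∃ N : ℝ → ℝ, ∀ i s t, 0 ≤ s → s ≤ t → t ≤ T →
      |ksIntegral (fun s => k (x s) s) h₀ 0 t i - ksIntegral (fun s => k (x s) s) h₀ 0 s i| ≤
        N t - N s := by
  obtain ⟨N, -, -, hN⟩ := HasGI.exists_indefinite hT hm
  have hcl := clamp_mem hT
  have hrange : range (fun s => x (clamp T s)) ⊆ Ω := by
    rintro _ ⟨s, rfl⟩
    exact hxΩ _ (hcl s)
  have main : ∀ i, ∀ b ∈ Icc 0 T, ∃ I, HasKS (fun s => k (x s) s i) h₀ 0 b I ∧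
      HasGI (fun s τ t => ksIntegral (k (x τ)) h₀ 0 t i - ksIntegral (k (x τ)) h₀ 0 s i) 0 b I := by
    intro i b hb
    have hmem : ∀ s ∈ Icc 0 b, s ∈ Icc 0 T := fun s hs => ⟨hs.1, hs.2.trans hb.2⟩
    -- The scalar theorem asks for limits, continuity and bounds at every real point, so everything
    -- is made constant outside [0, T]. The integrals over subintervals do not notice.
    obtain ⟨I, hI, hI'⟩ := hasGI_superposition (x := fun s => x (clamp T s))
      (k := fun y s => k y (clamp T s) i) (K := fun y t => ksIntegral (k y) h₀ 0 t i)
      (m := fun s => m (clamp T s)) (b := b) hV hh hb.1 (hx.exists_tendsto_left hT)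
      (hx.exists_tendsto_right hT)
      (fun s => (PiLp.proj (𝕜 := ℝ) 1 (fun _ : Fin n => ℝ) i).continuous.comp_continuousOn
        ((hc _ (hcl s)).mono hrange))
      (HasKS.congr (u := m) (hN 0 b le_rfl hb.1 hb.2)
        fun s hs => by rw [clamp_of_mem (hmem s hs)])
      (fun y hy s => (PiLp.norm_apply_le _ i).trans (hkm y (hrange hy) _ (hcl s)))
      (fun y hy s t h1 h2 h3 => ((hasKS_ksIntegral hT (hk y (hrange hy))).2 i s t h1 h2
        (h3.trans hb.2)).congr_integrator
        (fun r hr => by rw [clamp_of_mem ⟨h1.trans hr.1, hr.2.trans (h3.trans hb.2)⟩])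
        (fun r hr => (e r ⟨h1.trans hr.1, hr.2.trans (h3.trans hb.2)⟩).symm))
    refine ⟨I, hI.congr_integrator (fun s hs => by rw [clamp_of_mem (hmem s hs)])
      (fun s hs => e s (hmem s hs)), hI'.congr fun s τ t h1 h2 h3 h4 => ?_⟩
    rw [clamp_of_mem (hmem τ (by rcases h4 with rfl | rfl <;> constructor <;> linarith))]
  have hint : KSIntegrable (fun s => k (x s) s) h₀ 0 T := ksIntegrable_iff.2 fun i => by
    obtain ⟨I, hI, -⟩ := main i T ⟨hT, le_rfl⟩
    exact ⟨I, hI⟩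
  obtain ⟨z0, hks⟩ := hasKS_ksIntegral hT hint
  refine ⟨hint, fun s hs => ?_, N, fun i s t h1 h2 h3 => ?_⟩
  · rw [hasKurzweilIntegral_iff, hasGI_iff_apply]
    intro i
    obtain ⟨I, hI, hI'⟩ := main i s hs
    have h1 := hks i 0 s le_rfl hs.1 hs.2
    rw [z0, PiLp.zero_apply, sub_zero] at h1
    rw [HasGI.unique hs.1 h1 hI]
    exact hI'
  · refine HasKS.abs_le hV h2 ((hks i s t h1 h2 h3).congr_integrator (fun _ _ => rfl)
      (fun r hr => (e r ⟨h1.trans hr.1, hr.2.trans h3⟩).symm)) (hN s t h1 h2 h3) fun r hr => ?_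
    have hr' : r ∈ Icc 0 T := ⟨h1.trans hr.1, hr.2.trans h3⟩
    exact (PiLp.norm_apply_le _ i).trans (hkm _ (hxΩ r hr') r hr')

/-- Superposition of a Carathéodory function with a regulated function is integrable. -/
lemma integrableOn_superposition (hT : 0 ≤ T) {Ω : Set (Rn n)} {k : Rn n → ℝ → Rn n}
    {x : ℝ → Rn n} {m : ℝ → ℝ} (hx : RegulatedOn x T) (hxΩ : ∀ t ∈ Icc 0 T, x t ∈ Ω)
    (hc : ∀ t ∈ Icc 0 T, ContinuousOn (fun y => k y t) Ω) (hm : IntegrableOn m (Icc 0 T))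
    (hkm : ∀ y ∈ Ω, ∀ t ∈ Icc 0 T, ‖k y t‖ ≤ m t)
    (hk : ∀ y ∈ Ω, AEStronglyMeasurable (k y) (volume.restrict (Icc 0 T))) :
    IntegrableOn (fun t => k (x t) t) (Icc 0 T) := by
  have hcl := clamp_mem hT
  -- Half-open intervals concatenate exactly, while a step function is controlled only on open ones.
  -- The difference is a null set.
  have hIco : ∀ s t : ℝ, volume.restrict (Ico s t) = volume.restrict (Ioo s t) := fun s t =>
    Measure.restrict_congr_set Ioo_ae_eq_Ico.symm
  choose y hy hy' using fun j : ℕ => exists_step_approx (x := fun s => x (clamp T s))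
    (hx.exists_tendsto_left hT) (hx.exists_tendsto_right hT)
    (show (0 : ℝ) < 1 / ((j : ℝ) + 1) by positivity) hT
    (fun y s t => AEStronglyMeasurable (fun q => k (y q) q) (volume.restrict (Ico s t)))
    (fun t => by simp)
    (fun s t c y h1 h2 h3 h4 => by
      rw [hIco]
      refine AEStronglyMeasurable.congr ((hk _ (hxΩ _ (hcl c))).mono_set
        (Ioo_subset_Icc_self.trans (Icc_subset_Icc h1 h3))) ?_
      filter_upwards [ae_restrict_mem measurableSet_Ioo] with q hq
      rw [h4 q hq])
    (fun y₁ y₂ r s t _ h1 h2 _ H1 H2 => by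
      rw [← Ico_union_Ico_eq_Ico h1 h2, aestronglyMeasurable_union_iff]
      constructor
      · refine H1.congr ?_
        filter_upwards [ae_restrict_mem measurableSet_Ico] with q hq
        rw [if_pos hq.2]
      · refine H2.congr ?_
        filter_upwards [ae_restrict_mem measurableSet_Ico] with q hq
        rw [if_neg (not_lt.2 hq.1)])
  have hmeas : AEStronglyMeasurable (fun t => k (x t) t) (volume.restrict (Icc 0 T)) := by
    rw [← Measure.restrict_congr_set (Ico_ae_eq_Icc (μ := volume) (a := (0 : ℝ)) (b := T))]
    refine aestronglyMeasurable_of_tendsto_ae atTop hy ?_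
    filter_upwards [ae_restrict_mem measurableSet_Ico] with q hq
    have hq' : q ∈ Icc 0 T := ⟨hq.1, hq.2.le⟩
    refine (hc q hq' (x q) (hxΩ q hq')).tendsto.comp (tendsto_nhdsWithin_iff.2
      ⟨?_, Eventually.of_forall fun j => ?_⟩)
    · rw [tendsto_iff_dist_tendsto_zero]
      refine squeeze_zero (fun _ => dist_nonneg) (fun j => ?_)
        tendsto_one_div_add_atTop_nhds_zero_nat
      simpa only [clamp_of_mem hq'] using (hy' j q).1
    · obtain ⟨s, hs⟩ := (hy' j q).2
      rw [← hs]
      exact hxΩ _ (hcl s)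
  refine Integrable.mono' hm hmeas ?_
  filter_upwards [ae_restrict_mem measurableSet_Icc] with q hq
  exact hkm _ (hxΩ q hq) q hq

/-- The distributional equation in terms of `x - ∫ f - ∫ g dh`. -/
lemma equation_iff (hT : 0 ≤ T) {x u v : ℝ → Rn n} {h : ℝ → ℝ}
    (hx : ∀ i, IntervalIntegrable (fun t => x t i) volume 0 T) (hu : IntegrableOn u (Icc 0 T))
    (hv : ∀ i, IntervalIntegrable (fun t => ksIntegral v h 0 t i) volume 0 T) (φ : TestFun n T) :
    distDeriv (ofFun T x) φ = ofFun T u φ + mulDeriv T v h φ ↔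
      ∑ i, ∫ t in (0 : ℝ)..T, (x t i - ksIntegral u id 0 t i - ksIntegral v h 0 t i) *
        deriv (fun t => φ.toFun t i) t = 0 := by
  have hui : ∀ i, IntervalIntegrable (fun t => u t i) volume 0 T := fun i =>
    (intervalIntegrable_iff_integrableOn_Icc_of_le hT).2 (integrableOn_apply hu i)
  rw [mulDeriv, distDeriv_ofFun_eq_sum hx, ofFun_eq_sum hui, distDeriv_ofFun_eq_sum hv]
  have key : ∀ i, ∫ t in (0 : ℝ)..T, (x t i - ksIntegral u id 0 t i - ksIntegral v h 0 t i) *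
      deriv (fun t => φ.toFun t i) t =
      (∫ t in (0 : ℝ)..T, x t i * deriv (fun t => φ.toFun t i) t) +
      (∫ t in (0 : ℝ)..T, u t i * φ.toFun t i) -
      ∫ t in (0 : ℝ)..T, ksIntegral v h 0 t i * deriv (fun t => φ.toFun t i) t := by
    intro i
    have hd : ContinuousOn (deriv fun t => φ.toFun t i) (uIcc 0 T) :=
      ((φ.contDiff_apply i).continuous_deriv (by exact_mod_cast le_top)).continuousOn
    have hp : ContinuousOn (fun t => ∫ s in (0 : ℝ)..t, u s i) (uIcc 0 T) :=
      ((hui i).absolutelyContinuousOnInterval_intervalIntegral left_mem_uIcc).continuousOn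
    have i1 := (hx i).mul_continuousOn hd
    have i2 : IntervalIntegrable (fun t => (∫ s in (0 : ℝ)..t, u s i) *
        deriv (fun t => φ.toFun t i) t) volume 0 T := (hp.mul hd).intervalIntegrable
    have i3 := (hv i).mul_continuousOn hd
    have ibp := integral_primitive_mul_deriv (hui i) (φ.contDiff_apply i)
      (by rw [φ.apply_zero]; rfl) (by rw [φ.apply_right]; rfl)
    rw [← neg_neg (∫ t in (0 : ℝ)..T, u t i * φ.toFun t i), ← ibp, ← sub_eq_add_neg,
      ← intervalIntegral.integral_sub i1 i2, ← intervalIntegral.integral_sub (i1.sub i2) i3]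
    refine intervalIntegral.integral_congr fun t ht => ?_
    rw [uIcc_of_le hT] at ht
    beta_reduce
    rw [ksIntegral_id_apply hu ht]
    ring
  rw [Finset.sum_congr rfl fun i _ => key i, Finset.sum_sub_distrib, Finset.sum_add_distrib]
  constructor <;> intro H <;> linarith

end Vector

/-! ### From the distributional equation to the integral equation -/

section Equations

variable {n : ℕ} {T : ℝ}

/-- If the distributional equation and the initial condition hold, then so does the integral
equation. -/
lemma eq_of_equation (hT : 0 < T) {x u v : ℝ → Rn n} {h : ℝ → ℝ}
    (hbv : BoundedVariationOn x (Icc 0 T))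
    (hxc : ∀ t ∈ Ioc 0 T, ContinuousWithinAt x (Iic t) t)
    (hh : ∀ t ∈ Ioc 0 T, ContinuousWithinAt h (Iic t) t)
    (hu : IntegrableOn u (Icc 0 T)) (hv : KSIntegrable v h 0 T)
    (hvi : ∀ i, IntervalIntegrable (fun t => ksIntegral v h 0 t i) volume 0 T)
    (heq : ∀ φ : TestFun n T,
      distDeriv (ofFun T x) φ = ofFun T u φ + mulDeriv T v h φ)
    (h0 : Tendsto (fun t => x t - x 0 - (h t - h 0) • v 0) (𝓝[>] 0) (𝓝 0)) :
    ∀ t ∈ Icc 0 T, x t - x 0 = ksIntegral u id 0 t + ksIntegral v h 0 t := by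
  have hxi : ∀ i, IntervalIntegrable (fun t => x t i) volume 0 T := fun i =>
    BoundedVariationOn.intervalIntegrable_real hT.le
      ((PiLp.proj (𝕜 := ℝ) 1 (fun _ : Fin n => ℝ) i).lipschitz.comp_boundedVariationOn hbv)
  obtain ⟨zu, hΦ⟩ := hasKS_ksIntegral hT.le (ksIntegrable_id hT.le hu)
  obtain ⟨zv, hΨ⟩ := hasKS_ksIntegral hT.le hv
  set Φ := fun t => ksIntegral u id 0 t with hΦd
  set Ψ := fun t => ksIntegral v h 0 t with hΨd
  have hΦc : ∀ i, ∀ t ∈ Ioc 0 T, ContinuousWithinAt (fun s => Φ s i) (Iic t) t := fun i t ht =>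
    continuousWithinAt_indefinite (fun r s h1 h2 h3 => hΦ i r s h1 h2 (h3.trans ht.2)) ht.1
      continuousWithinAt_id
  have hΨc : ∀ i, ∀ t ∈ Ioc 0 T, ContinuousWithinAt (fun s => Ψ s i) (Iic t) t := fun i t ht =>
    continuousWithinAt_indefinite (fun r s h1 h2 h3 => hΨ i r s h1 h2 (h3.trans ht.2)) ht.1
      (hh t ht)
  have hΦi : ∀ i, IntervalIntegrable (fun t => Φ t i) volume 0 T := fun i => by
    have hui := (intervalIntegrable_iff_integrableOn_Icc_of_le hT.le).2 (integrableOn_apply hu i)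
    have hp : ContinuousOn (fun t => ∫ s in (0 : ℝ)..t, u s i) (uIcc 0 T) :=
      (hui.absolutelyContinuousOnInterval_intervalIntegral left_mem_uIcc).continuousOn
    refine (hp.congr fun t ht => ?_).intervalIntegrable
    rw [uIcc_of_le hT.le] at ht
    exact ksIntegral_id_apply hu ht i
  intro t ht
  rcases ht.1.eq_or_lt with rfl | ht0
  · rw [sub_self, zu, zv, add_zero]
  ext i
  -- Test functions with a single nonzero component decouple the system. The constant is obtained
  -- only on (0, T], and the value at 0 has to come from the jump condition.
  have hw : ∃ c, ∀ t ∈ Ioc 0 T, x t i - Φ t i - Ψ t i = c := by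
    obtain ⟨c, hc⟩ := ae_eq_const_of_integral_mul_deriv_eq_zero hT
      (w := fun t => x t i - Φ t i - Ψ t i) (((hxi i).sub (hΦi i)).sub (hvi i)) fun φ hφ hφ' => by
        have := (equation_iff hT.le hxi hu hvi (TestFun.single i φ hφ hφ')).1 (heq _)
        simp only [TestFun.single_apply] at this
        rw [Finset.sum_eq_single i] at this
        · simpa using this
        · intro j _ hj
          simp [hj]
        · simp
    refine ⟨c, eq_const_of_ae_of_leftContinuous (fun t ht => ?_) hc⟩
    exact ((tendsto_Rn_iff.1 (hxc t ht) i).sub (hΦc i t ht)).sub (hΨc i t ht)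
  obtain ⟨c, hc⟩ := hw
  have l1 := tendsto_Rn_iff.1 h0 i
  have l2 := tendsto_indefinite_right (hΦ i) hT
  have l3 := tendsto_indefinite_right (hΨ i) hT
  have l4 : Tendsto (fun t : ℝ => u 0 i * (id t - id 0)) (𝓝[>] 0) (𝓝 0) := by
    have : Tendsto (fun t : ℝ => u 0 i * (id t - id 0)) (𝓝 0) (𝓝 (u 0 i * (id 0 - id 0))) :=
      ((continuous_id.tendsto 0).sub_const _).const_mul _
    rw [sub_self, mul_zero] at this
    exact this.mono_left nhdsWithin_le_nhds
  have l5 := ((l1.sub l2).sub l3).sub l4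
  -- The jump terms of `x` and of ∫ v dh cancel, although neither is assumed to converge separately,
  -- and what remains is the constant c - x(0).
  have l6 : Tendsto (fun _ : ℝ => c - x 0 i) (𝓝[>] 0) (𝓝 0) := by
    simp only [PiLp.zero_apply, sub_self] at l5
    refine l5.congr' ?_
    filter_upwards [Ioo_mem_nhdsGT hT] with s hs
    rw [← hc s ⟨hs.1, hs.2.le⟩]
    simp only [PiLp.sub_apply, PiLp.smul_apply, smul_eq_mul, zu, zv, PiLp.zero_apply, hΦd, hΨd]
    ring
  have hcx : c - x 0 i = 0 := tendsto_nhds_unique tendsto_const_nhds l6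
  have := hc t ⟨ht0, ht.2⟩
  simp only [PiLp.sub_apply, PiLp.add_apply]
  simp only [hΦd, hΨd] at this
  linarith

end Equations

/-! ### The integrator made constant outside `[0, T]` -/

lemma continuousWithinAt_comp_clamp {h : ℝ → ℝ} {T : ℝ} (hT : 0 ≤ T)
    (h_left : ∀ t ≤ T, ContinuousWithinAt h (Iic t) t) (t : ℝ) :
    ContinuousWithinAt (fun s => h (clamp T s)) (Iic t) t :=
  (h_left _ (clamp_mem hT t).2).comp (continuous_clamp T).continuousWithinAt
    fun _ hs => monotone_clamp T hs

lemma boundedVariationOn_comp_clamp {h : ℝ → ℝ} {T : ℝ} (hT : 0 ≤ T)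
    (h_bv : BoundedVariationOn h (Icc 0 T)) :
    BoundedVariationOn (fun s => h (clamp T s)) univ :=
  ne_top_of_le_ne_top h_bv (eVariationOn.comp_le_of_monotoneOn h (clamp T)
    ((monotone_clamp T).monotoneOn _) fun s _ => clamp_mem hT s)

lemma variationOnFromTo_comp_clamp {h : ℝ → ℝ} {T t : ℝ} (ht : t ∈ Icc 0 T) :
    variationOnFromTo (fun s => h (clamp T s)) univ 0 t = (eVariationOn h (Icc 0 t)).toReal := by
  rw [variationOnFromTo.eq_of_le _ _ ht.1, univ_inter]
  congr 1
  exact eVariationOn.congr fun s hs => by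
    simp only [clamp_of_mem (⟨hs.1, hs.2.trans ht.2⟩ : s ∈ Icc 0 T)]

end MDE

/-! ### Equivalence of the two equations -/

open MDE in
theorem mainTheorem9 (n : ℕ) (T : ℝ) (hT : 0 < T)
    (Λ : Set ℝ) (hΛ : IsOpen Λ) (Ω : Set (MDE.Rn n)) (hΩ : IsOpen Ω)
    (f : ℝ → MDE.Rn n → ℝ → MDE.Rn n) (g : MDE.Rn n → ℝ → MDE.Rn n) (h : ℝ → ℝ)
    -- `h` is left-continuous on `(-∞, T]`, of bounded variation on `[0, T]`, constant on `(-∞, 0]`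
    (h_left : ∀ t ≤ T, ContinuousWithinAt h (Iic t) t)
    (h_bv : BoundedVariationOn h (Icc 0 T))
    (h_const : ∀ t < 0, h t = h 0)
    -- Caratheodory conditions on `f`
    (f_cont : ∀ lam ∈ Λ, ∀ t ∈ Icc 0 T, ContinuousOn (fun x => f lam x t) Ω)
    (f_meas : ∀ lam ∈ Λ, ∀ x ∈ Ω,
      AEStronglyMeasurable (fun t => f lam x t) (volume.restrict (Icc 0 T)))
    (f_bound : ∃ m : ℝ → ℝ, (∀ t ∈ Icc 0 T, 0 ≤ m t) ∧ IntegrableOn m (Icc 0 T) ∧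
      ∀ lam ∈ Λ, ∀ x ∈ Ω, ∀ t ∈ Icc 0 T, ‖f lam x t‖ ≤ m t)
    -- conditions on `g`
    (g_cont : ∀ t ∈ Icc 0 T, ContinuousOn (fun x => g x t) Ω)
    (g_bound : ∃ m : ℝ → ℝ, (∀ t ∈ Icc 0 T, 0 ≤ m t) ∧
      MDE.KSIntegrable m (fun t => (eVariationOn h (Icc 0 t)).toReal) 0 T ∧
      ∀ x ∈ Ω, ∀ t ∈ Icc 0 T, ‖g x t‖ ≤ m t)
    -- the integrals `∫ g(x, s) dh(s)` defining `F` exist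
    (g_int : ∀ x ∈ Ω, MDE.KSIntegrable (fun t => g x t) h 0 T)
    (x : ℝ → MDE.Rn n) (hx : MDE.RegulatedOn x T) (lam : ℝ) (hlam : lam ∈ Λ) :
    MDE.IsMDESolution T Λ Ω f g h x lam ∧ MDE.InitialJump g h x ↔
      MDE.IsGODESolution T Λ Ω (MDE.rhs f g h) x lam := by
  obtain ⟨m, -, hm, hfm⟩ := f_bound
  obtain ⟨m', -, hm', hgm⟩ := g_bound
  have hf_int : ∀ y ∈ Ω, IntegrableOn (f lam y) (Icc 0 T) := fun y hy =>
    hm.mono' (f_meas lam hlam y hy) <| by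
      filter_upwards [ae_restrict_mem measurableSet_Icc] with t ht using hfm lam hlam y hy t ht
  have hV := isVariation_of_boundedVariationOn (boundedVariationOn_comp_clamp hT.le h_bv)
  obtain ⟨M', hM'⟩ := exists_hasKS_of_ksIntegrable hm'
  have hhc : ∀ t ∈ Ioc 0 T, ContinuousWithinAt h (Iic t) t := fun t ht => h_left t ht.2
  by_cases hxΩ : ∀ t ∈ Icc 0 T, x t ∈ Ω
  swap
  · exact ⟨fun H => absurd H.1.mem hxΩ, fun H => absurd H.mem hxΩ⟩
  have hF := integrableOn_superposition hT.le hx hxΩ (f_cont lam hlam) hm (hfm lam hlam)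
    (f_meas lam hlam)
  obtain ⟨fi, fK, N, hN⟩ := hasKurzweilIntegral_superposition hT.le
    (isVariation_of_monotone monotone_id) (h₀ := id) (fun t => continuousWithinAt_id)
    (fun _ _ => rfl) hx hxΩ (f_cont lam hlam) (hasKS_id_of_integrableOn hT.le hm)
    (hfm lam hlam) fun y hy => ksIntegrable_id hT.le (hf_int y hy)
  obtain ⟨gi, gK, N', hN'⟩ := hasKurzweilIntegral_superposition hT.le hV
    (continuousWithinAt_comp_clamp hT.le h_left)
    (fun s hs => by rw [clamp_of_mem hs]) hx hxΩ g_cont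
    (hM'.congr_integrator (fun _ _ => rfl) fun s hs => (variationOnFromTo_comp_clamp hs).symm)
    hgm g_int
  obtain ⟨zf, hΦ⟩ := hasKS_ksIntegral hT.le fi
  obtain ⟨zg, hΨ⟩ := hasKS_ksIntegral hT.le gi
  have hΨi : ∀ i, IntervalIntegrable (fun t => ksIntegral (fun t => g (x t) t) h 0 t i) volume 0 T :=
    fun i => BoundedVariationOn.intervalIntegrable_real hT.le <|
      boundedVariationOn_of_dist_le (M := N') fun s t h1 h2 h3 => by
        rw [dist_comm, Real.dist_eq]
        exact hN' i s t h1 h2 h3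
  -- The Kurzweil integral of DF along `x` exists for every regulated `x` with values in Ω, solution
  -- or not. The generalized equation is thereby reduced to the integral equation.
  have hFK : ∀ s ∈ Icc 0 T, HasKurzweilIntegral (fun τ t => rhs f g h lam (x τ) t) 0 s
      (ksIntegral (fun t => f lam (x t) t) id 0 s + ksIntegral (fun t => g (x t) t) h 0 s) := by
    intro s hs
    refine hasKurzweilIntegral_iff.2 (((hasKurzweilIntegral_iff.1 (fK s hs)).add
      (hasKurzweilIntegral_iff.1 (gK s hs))).congr fun _ _ _ _ _ _ _ => ?_)
    simp only [rhs]
    abel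
  constructor
  · rintro ⟨H, H0⟩
    refine ⟨hlam, hx, hxΩ, fun s hs => ?_⟩
    rw [eq_of_equation hT H.boundedVariation H.leftContinuous hhc hF gi hΨi H.equation H0 s hs]
    exact hFK s hs
  · intro H
    have key : ∀ s ∈ Icc 0 T, x s = x 0 + (ksIntegral (fun t => f lam (x t) t) id 0 s +
        ksIntegral (fun t => g (x t) t) h 0 s) := fun s hs => by
      rw [← (hasKurzweilIntegral_iff.1 (H.equation s hs)).unique hs.1
        (hasKurzweilIntegral_iff.1 (hFK s hs)), add_sub_cancel]
    have hbv : BoundedVariationOn x (Icc 0 T) := by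
      -- The norm is the sum over the `n` components, and each component of an increment of `x` is
      -- at most the increment of N + N', the indefinite integrals of the two majorants.
      refine boundedVariationOn_of_dist_le (M := fun t => ∑ _i : Fin n, (N t + N' t))
        fun s t h1 h2 h3 => ?_
      rw [dist_comm, dist_eq_norm, PiLp.norm_eq_of_L1, ← Finset.sum_sub_distrib]
      refine Finset.sum_le_sum fun i _ => ?_
      rw [key s ⟨h1, h2.trans h3⟩, key t ⟨h1.trans h2, h3⟩]
      have e1 := abs_le.1 (hN i s t h1 h2 h3)
      have e2 := abs_le.1 (hN' i s t h1 h2 h3)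
      simp only [PiLp.sub_apply, PiLp.add_apply, Real.norm_eq_abs]
      rw [abs_le]
      constructor <;> linarith
    have hxi : ∀ i, IntervalIntegrable (fun t => x t i) volume 0 T := fun i =>
      BoundedVariationOn.intervalIntegrable_real hT.le
        ((PiLp.proj (𝕜 := ℝ) 1 (fun _ : Fin n => ℝ) i).lipschitz.comp_boundedVariationOn hbv)
    refine ⟨⟨hlam, hbv, fun t ht => ?_, hxΩ, hF, gi, fun φ => ?_⟩, ?_⟩
    · refine tendsto_Rn_iff.2 fun i => ?_
      have c1 := continuousWithinAt_indefinite
        (fun r s h1 h2 h3 => hΦ i r s h1 h2 (h3.trans ht.2)) ht.1 continuousWithinAt_id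
      have c2 := continuousWithinAt_indefinite
        (fun r s h1 h2 h3 => hΨ i r s h1 h2 (h3.trans ht.2)) ht.1 (hhc t ht)
      have c3 := (c1.add c2).const_add (x 0 i)
      have e : x t i = x 0 i + (ksIntegral (fun t => f lam (x t) t) id 0 t i +
          ksIntegral (fun t => g (x t) t) h 0 t i) := by
        conv_lhs => rw [key t ⟨ht.1.le, ht.2⟩]
        rfl
      rw [e]
      refine Tendsto.congr' ?_ c3
      filter_upwards [Ioc_mem_nhdsLE ht.1] with s hs
      conv_rhs => rw [key s ⟨hs.1.le, hs.2.trans ht.2⟩]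
      rfl
    · rw [equation_iff hT.le hxi hF hΨi]
      refine Finset.sum_eq_zero fun i _ => ?_
      have e : EqOn (fun t => (x t i - ksIntegral (fun t => f lam (x t) t) id 0 t i -
          ksIntegral (fun t => g (x t) t) h 0 t i) * deriv (fun t => φ.toFun t i) t)
          (fun t => x 0 i * deriv (fun t => φ.toFun t i) t) (uIcc 0 T) := fun t ht => by
        rw [uIcc_of_le hT.le] at ht
        have := congrArg (fun y : Rn n => y i) (key t ht)
        simp only [PiLp.add_apply] at this
        simp only [this]
        ring
      rw [intervalIntegral.integral_congr e, intervalIntegral.integral_const_mul,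
        integral_deriv_eq_zero (φ.contDiff_apply i) (by rw [φ.apply_zero]; rfl)
        (by rw [φ.apply_right]; rfl), mul_zero]
    · refine tendsto_Rn_iff.2 fun i => ?_
      have l2 := tendsto_indefinite_right (hΦ i) hT
      have l3 := tendsto_indefinite_right (hΨ i) hT
      -- The jump formula for ∫ f dt carries the term f(λ, x(0), 0)t, which vanishes in the limit,
      -- so only `h` contributes to the jump of `x`.
      have l4 : Tendsto (fun t : ℝ => f lam (x 0) 0 i * (id t - id 0)) (𝓝[>] 0) (𝓝 0) := by
        have : Tendsto (fun t : ℝ => f lam (x 0) 0 i * (id t - id 0)) (𝓝 0)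
            (𝓝 (f lam (x 0) 0 i * (id 0 - id 0))) :=
          ((continuous_id.tendsto 0).sub_const _).const_mul _
        rw [sub_self, mul_zero] at this
        exact this.mono_left nhdsWithin_le_nhds
      have l5 := (l2.add l3).add l4
      simp only [add_zero] at l5
      refine l5.congr' ?_
      filter_upwards [Ioo_mem_nhdsGT hT] with s hs
      have := congrArg (fun y : Rn n => y i) (key s ⟨hs.1.le, hs.2.le⟩)
      simp only [PiLp.add_apply] at this
      simp only [PiLp.sub_apply, PiLp.smul_apply, smul_eq_mul, zf, zg, PiLp.zero_apply, this]
      ring
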